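/- **Theorem (regret and sample complexity of CONGO-B).** *Setting.* Let $1\le s\le d$, $T\ge 1$, $L_f,L,R>0$. Let $\mathcal K\subset\mathbb R^d$ be compact and convex with $\sup_{x\in\mathcal K}\|x\|\le R$, let $x_1\in\mathcal K$, and put $D=\sup_{x,y\in\mathcal K}\tfrac12\|x-y\|^2$ ($\|\cdot\|$ is the Euclidean norm). Let $\mathcal F$ be the set of differentiable convex functions $f:\mathbb R^d\to\mathbb R$ that are $L_f$-Lipschitz, have $L$-Lipschitz gradient, and whose gradient $\nabla f(x)$ has at most $s$ nonzero coordinates for every $x\in\mathcal K$. On round $t=1,\dots,T$ the algorithm plays $x_t$, then an adversary picks $f_t\in\mathcal F$, which may depend (measurably) on everything drawn on rounds $1,\dots,t-1$ but not on the draws of round $t$ or later; the algorithm may sample values of $f_t$. *Algorithm CONGO-B with parameters $\eta,\delta,m$.* On round $t$ draw an $m\times d$ matrix $A$ with independent $\mathcal N(0,1)$ entries, with rows $a_1,\dots,a_m$, and query $f_t(x_t)$. Put $G=\max_i\|a_i\|$, $\gamma=\tfrac L2\delta\sqrt m$, and let $k$ be the least integer with $k\ge 1$ and $k\ge \frac{m(m-1)^2L_f^2G^2}{2\gamma^2}\log(2mT)$.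 For $l=1,\dots,k$ draw a vector $\Delta^l\in\{\pm1\}^m$ with independent uniform signs, independent of $A$, query $f_t$ at $x_t+\delta\|A^{\mathsf T}\Delta^l\|^{-2}A^{\mathsf T}\Delta^l$, and set $$y_i=\frac1k\sum_{l=1}^k\frac{f_t\big(x_t+\delta\|A^{\mathsf T}\Delta^l\|^{-2}A^{\mathsf T}\Delta^l\big)-f_t(x_t)}{\delta\|A^{\mathsf T}\Delta^l\|^{-2}\,\Delta^l_i},\qquad i=1,\dots,m.$$ If some $z$ satisfies $\big\|\tfrac1{\sqrt m}Az-\tfrac1{\sqrt m}y\big\|\le 3L\delta$ and $\|z\|\le L_f+3L\delta$, let $g_t$ be a minimizer of $\|z\|_1$ under these two constraints (any choice that is a measurable function of $(A,y)$); otherwise let $g_t=0$. Let $x_{t+1}$ be the point of $\mathcal K$ nearest to $x_t-\eta g_t$. Draws on different rounds are independent. *Claim.* There is an absolute constant $C>0$ such that, with $$\eta=\frac1{L_f\sqrt T},\qquad \delta=\frac1{3LT},\qquad m=\Big\lceil C\Big(2s\log\frac{ed}{2s}+\log(4T)\Big)\Big\rceil,$$ CONGO-B satisfies, against every such adversary,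 $$\mathbb E\Big[\sum_{t=1}^Tf_t(x_t)-\min_{x\in\mathcal K}\sum_{t=1}^Tf_t(x)\Big]= O\Big(\Big(D+\frac R2+\frac{4R}{L_f}\Big)L_f\sqrt T\Big),$$ where the bound holds for all $T\ge1$ and the implied constant depends only on a positive lower bound for $R$ (so it is absolute when $R\ge 1$); it does not depend on $T,d,s,L_f,L,\mathcal K,x_1$, the adversary or the choice of minimizers. Furthermore, on every round the expected number of samples of $f_t$ taken by the algorithm, $\mathbb E[k]+1$, is at most $$36\,d\,(m-1)^2L_f^2\log(2m)\,T^2\log(2mT)+2 .$$ -/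

import Mathlib

open MeasureTheory ProbabilityTheory
open scoped ENNReal

noncomputable section

namespace Congo

/-- Points of `ℝ^d`, with the Euclidean norm. -/
abbrev Vec (d : ℕ) : Type := EuclideanSpace ℝ (Fin d)

/-- Real `m × d` matrices, given by their rows. -/
abbrev Mat (m d : ℕ) : Type := Fin m → Fin d → ℝ

/-! ### Constraint set and admissible cost functions -/

/-- A vector is `s`-sparse when at most `s` of its coordinates are nonzero. -/
def IsSparse {d : ℕ} (s : ℕ) (v : Vec d) : Prop :=
  (Finset.univ.filter fun j => v j ≠ 0).card ≤ s

/-- `f : ℝ^d → ℝ` is convex, `Lf`-Lipschitz and `L`-smooth, and its gradient is `s`-sparse at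
every point of the constraint set `K`. -/
structure Admissible {d : ℕ} (K : Set (Vec d)) (Lf L : ℝ) (s : ℕ) (f : Vec d → ℝ) : Prop where
  convex : ConvexOn ℝ Set.univ f
  lipschitz : ∀ x y, |f x - f y| ≤ Lf * ‖x - y‖
  differentiable : Differentiable ℝ f
  smooth : ∀ x y, ‖gradient f x - gradient f y‖ ≤ L * ‖x - y‖
  sparse : ∀ x ∈ K, IsSparse s (gradient f x)

/-- `D = sup_{x, y ∈ K} ½ ‖x - y‖²`. -/
def halfSqDiam {d : ℕ} (K : Set (Vec d)) : ℝ :=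
  ⨆ p : K × K, (1 / 2) * ‖(p.1 : Vec d) - (p.2 : Vec d)‖ ^ 2

/-- The point of `K` nearest to `v` (unique when `K` is nonempty, closed and convex). -/
def project {d : ℕ} (K : Set (Vec d)) (v : Vec d) : Vec d :=
  Classical.epsilon fun p => p ∈ K ∧ ∀ z ∈ K, ‖p - v‖ ≤ ‖z - v‖

/-! ### Internal randomness of the algorithm -/

/-- The uniform distribution on `{1, -1}`. -/
def rademacher : Measure ℝ :=
  (2⁻¹ : ℝ≥0∞) • Measure.dirac 1 + (2⁻¹ : ℝ≥0∞) • Measure.dirac (-1)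

instance : IsProbabilityMeasure rademacher := by
  constructor
  simp [rademacher, ENNReal.inv_two_add_inv_two]

/-- The law of an `m × d` matrix with independent `N(0,1)` entries. -/
def gaussianMatrix (m d : ℕ) : Measure (Mat m d) :=
  Measure.pi fun _ => Measure.pi fun _ => gaussianReal 0 1

instance (m d : ℕ) : IsProbabilityMeasure (gaussianMatrix m d) := by
  unfold gaussianMatrix; infer_instance

/-- What is drawn on one round: a matrix, and a sequence of `m`-dimensional sign vectors
(of which the algorithm uses an initial segment). -/
abbrev Seed (m d : ℕ) : Type := Mat m d × (ℕ → Fin m → ℝ)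

/-- On one round the matrix is Gaussian and, independently of it, all signs are independent
Rademacher variables. -/
def seedLaw (m d : ℕ) : Measure (Seed m d) :=
  (gaussianMatrix m d).prod (Measure.infinitePi fun _ : ℕ => Measure.pi fun _ => rademacher)

instance (m d : ℕ) : IsProbabilityMeasure (seedLaw m d) := by
  unfold seedLaw; infer_instance

/-- Outcomes of all the draws; rounds are numbered `0, 1, 2, …`. -/
abbrev Outcome (m d : ℕ) : Type := ℕ → Seed m d

/-- The draws of different rounds are independent and identically distributed. -/
def outcomeLaw (m d : ℕ) : Measure (Outcome m d) :=
  Measure.infinitePi fun _ : ℕ => seedLaw m d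

instance (m d : ℕ) : IsProbabilityMeasure (outcomeLaw m d) := by
  unfold outcomeLaw; infer_instance

/-! ### One round of CONGO-B -/

/-- The vector `Aᵀ Δ`, a combination of the rows of `A`. -/
def rowCombination {m d : ℕ} (A : Mat m d) (Δ : Fin m → ℝ) : Vec d :=
  WithLp.toLp 2 fun j => ∑ i, A i j * Δ i

/-- The factor `δ / ‖Aᵀ Δ‖²`. -/
def stepScale {m d : ℕ} (δ : ℝ) (A : Mat m d) (Δ : Fin m → ℝ) : ℝ :=
  δ / ‖rowCombination A Δ‖ ^ 2

/-- The point `x + (δ / ‖Aᵀ Δ‖²) Aᵀ Δ`. -/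
def perturbed {m d : ℕ} (δ : ℝ) (A : Mat m d) (x : Vec d) (Δ : Fin m → ℝ) : Vec d :=
  x + stepScale δ A Δ • rowCombination A Δ

/-- The points at which the current cost function is sampled on a round with `k` repetitions. -/
def queries {m d : ℕ} (δ : ℝ) (k : ℕ) (ξ : Seed m d) (x : Vec d) : List (Vec d) :=
  x :: (List.range k).map fun l => perturbed δ ξ.1 x (ξ.2 l)

/-- The averaged measurement vector: the mean over `l < k` of the vectors `y^l` with
`y^l_i = (f (x + (δ / ‖Aᵀ Δ^l‖²) Aᵀ Δ^l) - f x) / ((δ / ‖Aᵀ Δ^l‖²) Δ^l_i)`. -/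
def measurement {m d : ℕ} (δ : ℝ) (k : ℕ) (f : Vec d → ℝ) (ξ : Seed m d) (x : Vec d) : Vec m :=
  WithLp.toLp 2 fun i => (1 / (k : ℝ)) * ∑ l ∈ Finset.range k,
    (f (perturbed δ ξ.1 x (ξ.2 l)) - f x) / (stepScale δ ξ.1 (ξ.2 l) * ξ.2 l i)

/-- The feasible set `‖A z - y‖ ≤ τ`, `‖z‖ ≤ ρ` of the recovery problem. -/
def feasible {m d : ℕ} (τ ρ : ℝ) (A : Mat m d) (y : Vec m) : Set (Vec d) :=
  {z | ‖(WithLp.toLp 2 fun i => ∑ j, A i j * z j : Vec m) - y‖ ≤ τ ∧ ‖z‖ ≤ ρ}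

/-- `rec` is a (measurable) basis-pursuit solver: it returns a minimizer of the `ℓ¹` norm over the
feasible set when that set is nonempty, and `0` otherwise. -/
structure IsBasisPursuit {m d : ℕ} (τ ρ : ℝ) (rec : Mat m d → Vec m → Vec d) : Prop where
  measurable : Measurable fun p : Mat m d × Vec m => rec p.1 p.2
  mem : ∀ A y, (feasible τ ρ A y).Nonempty → rec A y ∈ feasible τ ρ A y
  minimal : ∀ A y, ∀ z ∈ feasible τ ρ A y, ∑ j, |rec A y j| ≤ ∑ j, |z j|
  infeasible : ∀ A y, feasible τ ρ A y = ∅ → rec A y = 0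

/-- The gradient estimate: `A` and `y` are rescaled by `1 / √m` before the recovery. -/
def gradEstimate {m d : ℕ} (rec : Mat m d → Vec m → Vec d) (δ : ℝ) (k : ℕ)
    (f : Vec d → ℝ) (ξ : Seed m d) (x : Vec d) : Vec d :=
  rec (fun i j => (1 / √(m : ℝ)) * ξ.1 i j) ((1 / √(m : ℝ)) • measurement δ k f ξ x)

/-- The number of repetitions averaged over on a round with matrix `A`: with
`γ = ½ L δ √m` and `G` the largest Euclidean norm of a row of `A`, it is the least integer `k ≥ 1`
with `k ≥ m (m-1)² Lf² G² / (2 γ²) · log (2 m T)`. -/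
def repetitions {m d : ℕ} (Lf L δ : ℝ) (T : ℕ) (A : Mat m d) : ℕ :=
  let γ : ℝ := 1 / 2 * L * δ * √(m : ℝ)
  let G : ℝ := ⨆ i, ‖(WithLp.toLp 2 (A i) : Vec d)‖
  max 1 ⌈(m : ℝ) * ((m : ℝ) - 1) ^ 2 * Lf ^ 2 * G ^ 2 / (2 * γ ^ 2)
    * Real.log (2 * m * T)⌉₊

/-! ### The run of CONGO-B against an adversary -/

/-- An adversary: the cost function of round `t` may depend on everything that was drawn on
the earlier rounds (hence on the points played up to and including round `t`), but on nothing that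
is drawn on round `t` or later. -/
structure IsAdversary {m d : ℕ} (K : Set (Vec d)) (Lf L : ℝ) (s T : ℕ)
    (f : ℕ → Outcome m d → Vec d → ℝ) : Prop where
  admissible : ∀ t < T, ∀ ω, Admissible K Lf L s (f t ω)
  nonanticipating : ∀ t < T, ∀ ω ω' : Outcome m d, (∀ r < t, ω r = ω' r) → f t ω = f t ω'
  measurable : ∀ t < T, ∀ x, Measurable fun ω => f t ω x

/-- The point played on round `t`, started at `x₁` and updated by projected gradient steps. -/
def iterate {m d : ℕ} (K : Set (Vec d)) (Lf L η δ : ℝ) (T : ℕ)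
    (rec : Mat m d → Vec m → Vec d) (x₁ : Vec d) (f : ℕ → Outcome m d → Vec d → ℝ)
    (ω : Outcome m d) : ℕ → Vec d
  | 0 => x₁
  | t + 1 =>
    let x := iterate K Lf L η δ T rec x₁ f ω t
    project K (x - η • gradEstimate rec δ (repetitions Lf L δ T (ω t).1) (f t ω) (ω t) x)

/-- The regret after `T` rounds against the best fixed point of `K` in hindsight. -/
def regret {m d : ℕ} (K : Set (Vec d)) (Lf L η δ : ℝ) (T : ℕ)
    (rec : Mat m d → Vec m → Vec d) (x₁ : Vec d) (f : ℕ → Outcome m d → Vec d → ℝ)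
    (ω : Outcome m d) : ℝ :=
  ∑ t ∈ Finset.range T, f t ω (iterate K Lf L η δ T rec x₁ f ω t)
    - ⨅ u : K, ∑ t ∈ Finset.range T, f t ω u

/-- The number of samples of the cost function that are taken on round `t`. -/
def numSamples {m d : ℕ} (K : Set (Vec d)) (Lf L η δ : ℝ) (T : ℕ)
    (rec : Mat m d → Vec m → Vec d) (x₁ : Vec d) (f : ℕ → Outcome m d → Vec d → ℝ)
    (t : ℕ) (ω : Outcome m d) : ℕ :=
  (queries δ (repetitions Lf L δ T (ω t).1) (ω t) (iterate K Lf L η δ T rec x₁ f ω t)).length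

end Congo

end

namespace Congo

/-! The argument is projected gradient descent with an inexact gradient whose error is `O(1/T)`
except on rounds of probability at most `2/T`. With `D`, `ρ = Lf + 3Lδ` and errors `err t`, the
regret is at most `D/η + Tηρ²/2 + 2R ∑ err t`. The estimate is never longer than `ρ`, so a failed
round costs a bounded error and all failures together cost `O(R Lf + R)` in expectation.

A round succeeds for two reasons. Write `b = A ∇f(x)`. By smoothness each difference quotient equals
`⟨b, Δ⟩ Δ_i = b_i + ∑_{j ≠ i} b_j Δ_j Δ_i` up to `Lδ`; the cross terms have mean zero, and
Hoeffding's inequality with `k` repetitions makes their average at most `Lδ`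
(`signLaw_not_cross_le`). Hence the true gradient is feasible for the recovery problem, and the `ℓ¹`
minimizer differs from it by a vector `h` in the cone `‖h‖₁² ≤ 4s‖h‖²`.

The second reason is that `A` is bounded below on this cone. Instead of a net and restricted
isometry, only integer vectors of `ℓ¹` norm at most `128s + 1` and the column norms are tested.
Maurey's empirical method transfers the bound: `h / ‖h‖₁` is a convex combination of signed unit
vectors, a sum of `n` random ones is an integer test vector, and the variance of the sampling costs
only `b‖h‖₁²/(n - 1)` (`sum_sq_ge_of_int_vectors`). Chi-square tails and a count of the integer
points show that a Gaussian matrix passes all tests with probability at least `1 - 1/T`.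

The adversary's function and the point played depend on earlier draws only, so the gradient may be
frozen when the draw of round `t` is analysed (`outcomeLaw_real_le`). The sample count reduces to
`E[G²] ≤ 2d log(2m)` for the largest row norm `G` (`integral_maxRowNorm_sq_le`). -/

/-! ### Sparse recovery from integer test vectors -/

/-- Averaging a quadratic form over random sums: some sum of `n` of the vectors `v i` does at least
as well as the average over independent choices with weights `p i`. -/
lemma exists_list_sum_le {E ι : Type*} [AddCommGroup E] [Module ℝ E] [Fintype ι]
    (B : E →ₗ[ℝ] E →ₗ[ℝ] ℝ) (p : ι → ℝ) (hp : ∀ i, 0 ≤ p i) (hp1 : ∑ i, p i = 1)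
    (v : ι → E) (x : E) (hx : ∑ i, p i • v i = x) (n : ℕ) (y : E) :
    ∃ l : List ι, l.length = n ∧
      B (y + (l.map v).sum) (y + (l.map v).sum)
        ≤ B (y + (n : ℝ) • x) (y + (n : ℝ) • x) + n * (∑ i, p i * B (v i) (v i) - B x x) := by
  induction n generalizing y with
  | zero => exact ⟨[], by simp⟩
  | succ n ih =>
    -- The base point is shifted by one copy of the mean `x`; that copy is then exchanged for a
    -- single vector `v i`.
    obtain ⟨l, hl, hle⟩ := ih (y + x)
    set w := (l.map v).sum
    -- Bias-variance identity: the terms linear in `v i` average to those of `x`, so the exchange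
    -- costs exactly the variance.
    have havg : ∑ i, p i * B (y + w + v i) (y + w + v i)
        = B (y + w + x) (y + w + x) + (∑ i, p i * B (v i) (v i) - B x x) := by
      have h1 : ∑ i, p i * B (y + w) (v i) = B (y + w) x := by
        rw [← hx, map_sum]; simp
      have h2 : ∑ i, p i * B (v i) (y + w) = B x (y + w) := by
        rw [← hx, map_sum, LinearMap.sum_apply]; simp
      have h3 : ∀ i, p i * B (y + w + v i) (y + w + v i) = p i * B (y + w) (y + w)
          + p i * B (y + w) (v i) + p i * B (v i) (y + w) + p i * B (v i) (v i) := by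
        intro i
        rw [map_add B (y + w), LinearMap.add_apply, map_add (B (y + w)), map_add (B (v i))]
        ring
      simp_rw [h3]
      rw [Finset.sum_add_distrib, Finset.sum_add_distrib, Finset.sum_add_distrib, h1, h2,
        ← Finset.sum_mul, hp1]
      generalize y + w = u
      simp only [map_add, LinearMap.add_apply]
      ring
    obtain ⟨i, hi⟩ : ∃ i, B (y + w + v i) (y + w + v i)
        ≤ B (y + w + x) (y + w + x) + (∑ i, p i * B (v i) (v i) - B x x) := by
      by_contra! hcon
      set V := B (y + w + x) (y + w + x) + (∑ i, p i * B (v i) (v i) - B x x)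
      have hlt : ∑ i, p i * V < ∑ i, p i * B (y + w + v i) (y + w + v i) := by
        have hex : ∃ i ∈ Finset.univ, 0 < p i := by
          by_contra! h
          have : ∑ i, p i ≤ 0 := Finset.sum_nonpos h
          linarith
        obtain ⟨i, _, hi⟩ := hex
        exact Finset.sum_lt_sum (fun j _ => mul_le_mul_of_nonneg_left (hcon j).le (hp j))
          ⟨i, Finset.mem_univ i, mul_lt_mul_of_pos_left (hcon i) hi⟩
      rw [← Finset.sum_mul, hp1, one_mul, havg] at hlt
      exact lt_irrefl _ hlt
    refine ⟨i :: l, by simp [hl], ?_⟩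
    have e1 : y + (List.map v (i :: l)).sum = y + w + v i := by
      simp [w]; abel
    have e2 : y + ((n + 1 : ℕ) : ℝ) • x = y + x + (n : ℝ) • x := by
      push_cast; rw [add_smul, one_smul]; abel
    have e3 : y + x + w = y + w + x := by abel
    rw [e1, e2]
    rw [e3] at hle
    push_cast
    linarith

/-- The bilinear form `⟨A u, A w⟩ - a ⟨u, w⟩`. -/
noncomputable def gramForm {m d : ℕ} (A : Mat m d) (a : ℝ) :
    (Fin d → ℝ) →ₗ[ℝ] (Fin d → ℝ) →ₗ[ℝ] ℝ :=
  LinearMap.mk₂ ℝ (fun u w => ∑ i, (∑ j, A i j * u j) * (∑ j, A i j * w j) - a * ∑ j, u j * w j)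
    (by
      intro u u' w
      simp only [Pi.add_apply, mul_add, add_mul, Finset.sum_add_distrib]
      ring)
    (by
      intro c u w
      simp only [Pi.smul_apply, smul_eq_mul, mul_sub, Finset.mul_sum, Finset.sum_mul]
      congr 1
      · exact Finset.sum_congr rfl fun i _ => Finset.sum_congr rfl fun j _ =>
          Finset.sum_congr rfl fun k _ => by ring
      · exact Finset.sum_congr rfl fun i _ => by ring)
    (by
      intro u w w'
      simp only [Pi.add_apply, mul_add, Finset.sum_add_distrib]
      ring)
    (by
      intro c u w
      simp only [Pi.smul_apply, smul_eq_mul, mul_sub, Finset.mul_sum, Finset.sum_mul]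
      congr 1
      · exact Finset.sum_congr rfl fun i _ => Finset.sum_congr rfl fun j _ =>
          Finset.sum_congr rfl fun k _ => by ring
      · exact Finset.sum_congr rfl fun i _ => by ring)

lemma gramForm_self {m d : ℕ} (A : Mat m d) (a : ℝ) (u : Fin d → ℝ) :
    gramForm A a u u = ∑ i, (∑ j, A i j * u j) ^ 2 - a * ∑ j, u j ^ 2 := by
  simp [gramForm, sq]

/-- A sum of `n` signed unit vectors (or zeros) is an integer vector of `ℓ¹` norm at most `n`. -/
lemma exists_int_vector {d : ℕ} (σ : Fin d → ℤ) (hσ : ∀ j, |σ j| ≤ 1) (l : List (Fin d)) :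
    ∃ z : Fin d → ℤ, ∑ j, |z j| ≤ l.length ∧
      (l.map fun j => Pi.single (M := fun _ => ℝ) j (σ j : ℝ)).sum = fun j => (z j : ℝ) := by
  induction l with
  | nil => exact ⟨0, by simp, by ext; simp⟩
  | cons i l ih =>
    obtain ⟨z, hz, he⟩ := ih
    refine ⟨Pi.single i (σ i) + z, ?_, ?_⟩
    · calc ∑ j, |(Pi.single i (σ i) + z : Fin d → ℤ) j|
          ≤ ∑ j, (|(Pi.single i (σ i) : Fin d → ℤ) j| + |z j|) :=
            Finset.sum_le_sum fun j _ => abs_add_le _ _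
        _ = |σ i| + ∑ j, |z j| := by
            rw [Finset.sum_add_distrib]
            congr 1
            rw [Finset.sum_eq_single i] <;> simp +contextual
        _ ≤ ((i :: l).length : ℤ) := by
            have := hσ i
            push_cast [List.length_cons]
            linarith
    · rw [List.map_cons, List.sum_cons, he]
      ext j
      by_cases h : j = i
      · subst h; simp
      · simp [h]

/-- If `‖A z‖² ≥ a ‖z‖²` for integer vectors of `ℓ¹` norm at most `n` and the columns of `A` have
squared norm at most `b`, then a lower bound with an `ℓ¹` correction holds for all vectors. -/
lemma sum_sq_ge_of_int_vectors {m d n : ℕ} (A : Mat m d) {a b : ℝ} (ha : 0 ≤ a) (hn : 2 ≤ n)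
    (hlow : ∀ z : Fin d → ℤ, ∑ j, |z j| ≤ n →
      a * ∑ j, (z j : ℝ) ^ 2 ≤ ∑ i, (∑ j, A i j * (z j : ℝ)) ^ 2)
    (hcol : ∀ j, ∑ i, A i j ^ 2 ≤ b) (h : Fin d → ℝ) :
    a * ∑ j, h j ^ 2 - b * (∑ j, |h j|) ^ 2 / ((n : ℝ) - 1)
      ≤ ∑ i, (∑ j, A i j * h j) ^ 2 := by
  set M := ∑ j, |h j| with hM
  have hM0 : 0 ≤ M := Finset.sum_nonneg fun j _ => abs_nonneg _
  rcases hM0.eq_or_lt with hz | hpos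
  · have h0 : ∀ j, h j = 0 := by
      intro j
      have := (Finset.sum_eq_zero_iff_of_nonneg (fun j _ => abs_nonneg (h j))).1
        (hM.symm.trans hz.symm) j (Finset.mem_univ j)
      simpa using this
    simp [h0, ← hz]
  have hn1 : (0 : ℝ) < (n : ℝ) - 1 := by
    have : (2 : ℝ) ≤ n := by exact_mod_cast hn
    linarith
  have hb : 0 ≤ b := by
    have : Nonempty (Fin d) := by
      by_contra hne
      rw [not_nonempty_iff] at hne
      simp [hM] at hpos
    obtain ⟨j⟩ := this
    exact (Finset.sum_nonneg fun i _ => sq_nonneg (A i j)).trans (hcol j)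
  let σ : Fin d → ℤ := fun j => SignType.sign (h j)
  have hσ : ∀ j, |σ j| ≤ 1 := by
    intro j
    rcases lt_trichotomy (h j) 0 with hj | hj | hj <;> simp [σ, hj]
  have hσh : ∀ j, |h j| * (σ j : ℝ) = h j := by
    intro j
    rcases lt_trichotomy (h j) 0 with hj | hj | hj
    · simp [σ, hj, abs_of_neg]
    · simp [hj]
    · simp [σ, hj, abs_of_pos]
  set v : Fin d → Fin d → ℝ := fun j => Pi.single j (σ j : ℝ) with hv
  set x : Fin d → ℝ := M⁻¹ • h with hx
  have hsum : ∑ j, (|h j| / M) • v j = x := by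
    ext k
    rw [Finset.sum_apply, Finset.sum_eq_single k]
    · simp only [hv, Pi.smul_apply, Pi.single_eq_same, smul_eq_mul, hx]
      rw [div_mul_eq_mul_div, hσh]; field_simp
    · intro j _ hjk
      simp [hv, hjk.symm]
    · simp
  obtain ⟨l, hl, hle⟩ := exists_list_sum_le (gramForm A a) (fun j => |h j| / M)
    (fun j => by positivity) (by rw [← Finset.sum_div, ← hM, div_self hpos.ne']) v x hsum n 0
  obtain ⟨z, hz, he⟩ := exists_int_vector σ hσ l
  rw [zero_add, zero_add] at hle
  -- The selected sum is an integer test vector, so the form is nonnegative there; with `hle` this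
  -- gives `0 ≤ n² q(x) + n (b - q(x))`, where `q(x)` is `gramForm A a x x`.
  have hw : 0 ≤ gramForm A a (l.map v).sum (l.map v).sum := by
    rw [he, gramForm_self]
    have := hlow z (by rw [← hl]; exact hz)
    linarith
  have hvb : ∀ j, gramForm A a (v j) (v j) ≤ b := by
    intro j
    rw [gramForm_self]
    have e1 : ∑ k, v j k ^ 2 = (σ j : ℝ) ^ 2 := by
      rw [Finset.sum_eq_single j] <;> simp +contextual [hv]
    have e2 : ∀ i, ∑ k, A i k * v j k = A i j * σ j := by
      intro i
      rw [Finset.sum_eq_single j] <;> simp +contextual [hv]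
    simp_rw [e1, e2, mul_pow]
    rw [← Finset.sum_mul]
    have h1 : (σ j : ℝ) ^ 2 ≤ 1 := by
      rw [sq_le_one_iff_abs_le_one]; exact_mod_cast hσ j
    have h2 := hcol j
    have h3 : 0 ≤ ∑ i, A i j ^ 2 := Finset.sum_nonneg fun i _ => sq_nonneg _
    have h4 : 0 ≤ a * (σ j : ℝ) ^ 2 := by positivity
    nlinarith [sq_nonneg (σ j : ℝ)]
  have havg : ∑ j, |h j| / M * gramForm A a (v j) (v j) ≤ b := by
    calc ∑ j, |h j| / M * gramForm A a (v j) (v j) ≤ ∑ j, |h j| / M * b :=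
          Finset.sum_le_sum fun j _ => mul_le_mul_of_nonneg_left (hvb j) (by positivity)
      _ = b := by rw [← Finset.sum_mul, ← Finset.sum_div, ← hM, div_self hpos.ne', one_mul]
  have hn0 : (0 : ℝ) < n := by linarith
  have hq : gramForm A a ((n : ℝ) • x) ((n : ℝ) • x) = n ^ 2 * gramForm A a x x := by
    simp; ring
  rw [hq] at hle
  have hxx : -b ≤ ((n : ℝ) - 1) * gramForm A a x x := by
    have : 0 ≤ (n : ℝ) * ((n - 1) * gramForm A a x x + b) := by nlinarith
    have := nonneg_of_mul_nonneg_right this hn0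
    linarith
  have hqx : gramForm A a h h = M ^ 2 * gramForm A a x x := by
    have : h = M • x := by rw [hx, smul_smul, mul_inv_cancel₀ hpos.ne', one_smul]
    conv_lhs => rw [this]
    simp; ring
  have hfin : -(b * M ^ 2 / ((n : ℝ) - 1)) ≤ gramForm A a h h := by
    rw [hqx, neg_le_iff_add_nonneg, div_eq_mul_inv]
    have : 0 ≤ M ^ 2 * ((((n : ℝ) - 1) * gramForm A a x x + b) * ((n : ℝ) - 1)⁻¹) := by
      have : 0 ≤ ((n : ℝ) - 1) * gramForm A a x x + b := by linarith
      positivity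
    have e : M ^ 2 * ((((n : ℝ) - 1) * gramForm A a x x + b) * ((n : ℝ) - 1)⁻¹)
      = M ^ 2 * gramForm A a x x + b * M ^ 2 * ((n : ℝ) - 1)⁻¹ := by field_simp
    linarith
  rw [gramForm_self] at hfin
  linarith

/-- The cone condition for `ℓ¹` minimization around an `s`-sparse vector. -/
lemma l1_sub_le_of_sparse {d s : ℕ} (v g : Vec d) (hv : IsSparse s v)
    (hg : ∑ j, |g j| ≤ ∑ j, |v j|) :
    (∑ j, |g j - v j|) ^ 2 ≤ 4 * s * ∑ j, (g j - v j) ^ 2 := by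
  set S := Finset.univ.filter fun j => v j ≠ 0 with hS
  have h1 : ∑ j, |g j - v j| ≤ 2 * ∑ j ∈ S, |g j - v j| := by
    -- Off the support of `v` the left side vanishes; on it the triangle inequality gives twice the
    -- error. Cauchy-Schwarz on at most `s` coordinates then yields `4s`.
    have key : ∀ j, |g j - v j| + |v j| - |g j| ≤ if v j ≠ 0 then 2 * |g j - v j| else 0 := by
      intro j
      split_ifs with h
      · have := abs_sub_abs_le_abs_sub (v j) (g j)
        rw [abs_sub_comm] at this; linarith
      · push Not at h; simp [h]
    have := Finset.sum_le_sum fun j (_ : j ∈ Finset.univ) => key j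
    rw [Finset.sum_sub_distrib, Finset.sum_add_distrib, ← Finset.sum_filter, ← hS,
      ← Finset.mul_sum] at this
    linarith
  have h2 : (∑ j ∈ S, |g j - v j|) ^ 2 ≤ s * ∑ j, (g j - v j) ^ 2 := by
    calc (∑ j ∈ S, |g j - v j|) ^ 2 ≤ S.card * ∑ j ∈ S, |g j - v j| ^ 2 :=
          sq_sum_le_card_mul_sum_sq
      _ ≤ s * ∑ j, (g j - v j) ^ 2 := by
          have hc : (S.card : ℝ) ≤ s := by exact_mod_cast hv
          have : ∑ j ∈ S, |g j - v j| ^ 2 ≤ ∑ j, (g j - v j) ^ 2 := by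
            simp_rw [sq_abs]
            exact Finset.sum_le_sum_of_subset_of_nonneg (Finset.subset_univ _)
              fun _ _ _ => sq_nonneg _
          exact mul_le_mul hc this (Finset.sum_nonneg fun _ _ => by positivity) (by positivity)
  have h0 : 0 ≤ ∑ j, |g j - v j| := Finset.sum_nonneg fun j _ => abs_nonneg _
  calc (∑ j, |g j - v j|) ^ 2 ≤ (2 * ∑ j ∈ S, |g j - v j|) ^ 2 := pow_le_pow_left₀ h0 h1 2
    _ ≤ _ := by linarith [h2, mul_pow (2 : ℝ) (∑ j ∈ S, |g j - v j|) 2]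

/-- A matrix that is good for the recovery of `s`-sparse vectors. -/
structure IsGoodMatrix {m d : ℕ} (s : ℕ) (A : Mat m d) : Prop where
  lower : ∀ z : Fin d → ℤ, ∑ j, |z j| ≤ ((128 * s + 1 : ℕ) : ℤ) →
    (m : ℝ) / 4 * ∑ j, (z j : ℝ) ^ 2 ≤ ∑ i, (∑ j, A i j * (z j : ℝ)) ^ 2
  col : ∀ j, ∑ i, A i j ^ 2 ≤ 4 * m

/-- Stable recovery: any point of the tube with no larger `ℓ¹` norm than the sparse vector `v`, both
being `τ`-feasible, is within `6 τ` of `v`. -/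
lemma IsGoodMatrix.dist_le {m d s : ℕ} (hs : 1 ≤ s) (hm : 0 < m) {A : Mat m d}
    (hA : IsGoodMatrix s A) {v g : Vec d} (hv : IsSparse s v)
    (hg : ∑ j, |g j| ≤ ∑ j, |v j|) {τ ρ : ℝ} {y : Vec m}
    (hvf : v ∈ feasible τ ρ (fun i j => 1 / √(m : ℝ) * A i j) y)
    (hgf : g ∈ feasible τ ρ (fun i j => 1 / √(m : ℝ) * A i j) y) :
    ‖g - v‖ ≤ 6 * τ := by
  have hm' : (0 : ℝ) < m := by exact_mod_cast hm
  have hs' : (1 : ℝ) ≤ s := by exact_mod_cast hs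
  have hcone := l1_sub_le_of_sparse v g hv hg
  have hlow := sum_sq_ge_of_int_vectors A (a := (m : ℝ) / 4) (b := 4 * m) (by positivity)
    (n := 128 * s + 1) (by omega) hA.lower hA.col (fun j => g j - v j)
  set H := ∑ j, (g j - v j) ^ 2 with hH
  have hnorm : ‖g - v‖ ^ 2 = H := by
    rw [EuclideanSpace.real_norm_sq_eq]; simp [hH]
  have hlow2 : (m : ℝ) / 8 * H ≤ ∑ i, (∑ j, A i j * (g j - v j)) ^ 2 := by
    refine le_trans ?_ hlow
    -- The cone condition bounds the correction by `4m · 4sH / (128s) = mH/8`, half of the main term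
    -- `mH/4`; this fixes the test radius `128s + 1`.
    have : 4 * (m : ℝ) * (∑ j, |g j - v j|) ^ 2 / (((128 * s + 1 : ℕ) : ℝ) - 1) ≤ m / 8 * H := by
      push_cast
      rw [add_sub_cancel_right, div_le_iff₀ (by positivity)]
      nlinarith
    linarith
  have htri : ‖(WithLp.toLp 2 fun i => ∑ j, 1 / √(m : ℝ) * A i j * (g j - v j) : Vec m)‖
      ≤ 2 * τ := by
    have e : (WithLp.toLp 2 fun i => ∑ j, 1 / √(m : ℝ) * A i j * (g j - v j) : Vec m)
        = ((WithLp.toLp 2 fun i => ∑ j, 1 / √(m : ℝ) * A i j * g j : Vec m) - y)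
          - ((WithLp.toLp 2 fun i => ∑ j, 1 / √(m : ℝ) * A i j * v j : Vec m) - y) := by
      ext i
      simp [mul_sub, Finset.sum_sub_distrib]
    rw [e]
    refine (norm_sub_le _ _).trans ?_
    have h1 := hvf.1
    have h2 := hgf.1
    linarith
  have hτ : 0 ≤ τ := (norm_nonneg _).trans hvf.1
  have hsq : ‖(WithLp.toLp 2 fun i => ∑ j, 1 / √(m : ℝ) * A i j * (g j - v j) : Vec m)‖ ^ 2
      = (1 / m) * ∑ i, (∑ j, A i j * (g j - v j)) ^ 2 := by
    rw [EuclideanSpace.real_norm_sq_eq, Finset.mul_sum]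
    refine Finset.sum_congr rfl fun i _ => ?_
    simp only [mul_assoc]
    rw [← Finset.mul_sum, mul_pow, div_pow, Real.sq_sqrt hm'.le, one_pow]
  have h4 : (1 / (m : ℝ)) * ∑ i, (∑ j, A i j * (g j - v j)) ^ 2 ≤ (2 * τ) ^ 2 := by
    rw [← hsq]; exact pow_le_pow_left₀ (norm_nonneg _) htri 2
  have h5 : H ≤ 32 * τ ^ 2 := by
    rw [one_div, inv_mul_le_iff₀ hm'] at h4
    have : (m : ℝ) * H ≤ m * (32 * τ ^ 2) := by nlinarith
    exact le_of_mul_le_mul_left this hm'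
  refine abs_le_of_sq_le_sq' ?_ (by positivity) |>.2
  rw [hnorm]; nlinarith [sq_nonneg τ]

/-! ### Gaussian matrices -/

lemma integral_exp_mul_sq_gaussianReal {b : ℝ} (hb : b < 1 / 2) :
    ∫ x, Real.exp (b * x ^ 2) ∂(gaussianReal 0 1) = (√(1 - 2 * b))⁻¹ := by
  rw [integral_gaussianReal_eq_integral_smul one_ne_zero]
  have e : ∀ x : ℝ, gaussianPDFReal 0 1 x • Real.exp (b * x ^ 2)
      = (√(2 * Real.pi))⁻¹ * Real.exp (-(1 / 2 - b) * x ^ 2) := by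
    intro x
    simp only [gaussianPDFReal, smul_eq_mul, NNReal.coe_one, mul_one, sub_zero]
    rw [mul_assoc, ← Real.exp_add]
    ring_nf
  simp_rw [e]
  rw [integral_const_mul, integral_gaussian, ← Real.sqrt_inv, ← Real.sqrt_mul (by positivity),
    ← Real.sqrt_inv]
  congr 1
  have h1 : (1 / 2 - b) ≠ 0 := by linarith
  have h2 : 1 - 2 * b ≠ 0 := by linarith
  have := Real.pi_ne_zero
  field_simp

/-- A linear functional of a standard Gaussian vector is Gaussian. -/
lemma map_sum_mul_pi_gaussianReal {d : ℕ} (w : Fin d → ℝ) :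
    (Measure.pi fun _ : Fin d => gaussianReal 0 1).map (fun a => ∑ j, a j * w j)
      = gaussianReal 0 (∑ j, w j ^ 2).toNNReal := by
  set u : Vec d := WithLp.toLp 2 w
  have e : (fun a : Fin d → ℝ => ∑ j, a j * w j)
      = (innerSL ℝ u : Vec d → ℝ) ∘ (WithLp.toLp 2) := by
    ext a
    simp [u, PiLp.inner_apply]
  rw [e, ← Measure.map_map (by fun_prop) (by fun_prop), map_pi_eq_stdGaussian,
    IsGaussian.map_eq_gaussianReal, integral_strongDual_stdGaussian, variance_dual_stdGaussian,
    innerSL_apply_norm, EuclideanSpace.real_norm_sq_eq]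

/-- The rows are independent and each gives a centred Gaussian of variance `∑ w j ^ 2`, so this is
the `m`-th power of a scaled chi-square moment generating function. -/
lemma integral_exp_sq_gaussianMatrix {m d : ℕ} (w : Fin d → ℝ) {b : ℝ}
    (hb : b * ∑ j, w j ^ 2 < 1 / 2) :
    ∫ A, Real.exp (b * ∑ i, (∑ j, A i j * w j) ^ 2) ∂(gaussianMatrix m d)
      = ((√(1 - 2 * (b * ∑ j, w j ^ 2)))⁻¹) ^ m := by
  set W := ∑ j, w j ^ 2 with hW
  have hW0 : 0 ≤ W := Finset.sum_nonneg fun _ _ => sq_nonneg _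
  simp_rw [Finset.mul_sum, Real.exp_sum]
  rw [gaussianMatrix, integral_fintype_prod_eq_pow (ι := Fin m)
    (fun a : Fin d → ℝ => Real.exp (b * (∑ j, a j * w j) ^ 2)), Fintype.card_fin]
  congr 1
  rw [← integral_map (φ := fun a : Fin d → ℝ => ∑ j, a j * w j)
    (f := fun x : ℝ => Real.exp (b * x ^ 2)) (Measurable.aemeasurable (by fun_prop))
    (Continuous.aestronglyMeasurable (by fun_prop)), map_sum_mul_pi_gaussianReal, ← hW]
  have e : gaussianReal 0 W.toNNReal = (gaussianReal 0 1).map (fun x => √W * x) := by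
    rw [gaussianReal_map_const_mul]
    congr 1
    · simp
    · ext; simp [Real.sq_sqrt hW0, hW0]
  rw [e, integral_map (by fun_prop) (Continuous.aestronglyMeasurable (by fun_prop)),
    ← integral_exp_mul_sq_gaussianReal hb]
  simp_rw [mul_pow, Real.sq_sqrt hW0, mul_assoc]

lemma integrable_exp_sq_gaussianMatrix {m d : ℕ} (w : Fin d → ℝ) {b : ℝ}
    (hb : b * ∑ j, w j ^ 2 < 1 / 2) :
    Integrable (fun A => Real.exp (b * ∑ i, (∑ j, A i j * w j) ^ 2)) (gaussianMatrix m d) := by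
  -- A non-integrable function has integral `0` by convention, contradicting the positive value just
  -- computed.
  by_contra h
  have h1 := integral_exp_sq_gaussianMatrix (m := m) w hb
  rw [integral_undef h] at h1
  have : 0 < 1 - 2 * (b * ∑ j, w j ^ 2) := by linarith
  have : 0 < ((√(1 - 2 * (b * ∑ j, w j ^ 2)))⁻¹) ^ m := by positivity
  linarith

/-- Chernoff bound with `bW = -3/2`, chosen so that the square root is exactly `2`: the bound is
`2^{-m} e^{3m/8}`, and `log 2 - 3/8 > 1/4`. -/
lemma gaussianMatrix_lower_tail {m d : ℕ} (w : Fin d → ℝ) :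
    (gaussianMatrix m d).real
      {A | ∑ i, (∑ j, A i j * w j) ^ 2 < (m : ℝ) / 4 * ∑ j, w j ^ 2} ≤ Real.exp (-(m / 4 : ℝ)) := by
  set W := ∑ j, w j ^ 2 with hW
  have hW0 : 0 ≤ W := Finset.sum_nonneg fun _ _ => sq_nonneg _
  rcases hW0.eq_or_lt with h0 | hpos
  · rw [← h0]
    have : {A : Mat m d | ∑ i, (∑ j, A i j * w j) ^ 2 < (m : ℝ) / 4 * 0} = ∅ := by
      ext A
      simpa using Finset.sum_nonneg fun i _ => sq_nonneg (∑ j, A i j * w j)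
    rw [this]; simp [Real.exp_nonneg]
  set b := -(3 / 2) / W with hb
  have hbW : b * W = -(3 / 2) := by rw [hb]; field_simp
  have hb' : b * ∑ j, w j ^ 2 < 1 / 2 := by rw [← hW, hbW]; norm_num
  have hmk := mul_meas_ge_le_integral_of_nonneg (μ := gaussianMatrix m d)
    (Filter.Eventually.of_forall fun A => (Real.exp_pos _).le)
    (integrable_exp_sq_gaussianMatrix (m := m) w hb') (Real.exp (-(3 / 8 * m : ℝ)))
  rw [integral_exp_sq_gaussianMatrix w hb', ← hW, hbW] at hmk
  have hs : √(1 - 2 * -(3 / 2)) = 2 := by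
    rw [show (1 - 2 * -(3 / 2) : ℝ) = 2 ^ 2 by norm_num]; exact Real.sqrt_sq (by norm_num)
  rw [hs] at hmk
  have hsub : {A : Mat m d | ∑ i, (∑ j, A i j * w j) ^ 2 < (m : ℝ) / 4 * W}
      ⊆ {A | Real.exp (-(3 / 8 * m : ℝ)) ≤ Real.exp (b * ∑ i, (∑ j, A i j * w j) ^ 2)} := by
    intro A hA
    simp only [Set.mem_ofPred_eq] at hA ⊢
    rw [Real.exp_le_exp]
    have hbn : b < 0 := by rw [hb]; exact div_neg_of_neg_of_pos (by norm_num) hpos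
    have := mul_le_mul_of_nonpos_left hA.le hbn.le
    have e : b * ((m : ℝ) / 4 * W) = -(3 / 8 * m) := by
      rw [show b * ((m : ℝ) / 4 * W) = m / 4 * (b * W) by ring, hbW]; ring
    linarith
  refine (measureReal_mono hsub).trans ?_
  have h2 : ((2 : ℝ)⁻¹) ^ m = Real.exp (-(m * Real.log 2)) := by
    rw [Real.exp_neg, Real.exp_nat_mul, Real.exp_log (by norm_num), inv_pow]
  rw [h2] at hmk
  rw [← mul_le_mul_iff_right₀ (Real.exp_pos (-(3 / 8 * m : ℝ)))]
  refine hmk.trans ?_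
  rw [← Real.exp_add, Real.exp_le_exp]
  have := Real.log_two_gt_d9
  have hm : (0 : ℝ) ≤ m := by positivity
  nlinarith

/-- Chernoff bound with parameter `3/8`, for which the square root is `1/2`: the bound is `2^m
e^{-3m/2}`. -/
lemma gaussianMatrix_column_tail {m d : ℕ} (k : Fin d) :
    (gaussianMatrix m d).real {A | 4 * (m : ℝ) < ∑ i, A i k ^ 2} ≤ Real.exp (-(m / 4 : ℝ)) := by
  set w : Fin d → ℝ := Pi.single k 1 with hw
  have hW : ∑ j, w j ^ 2 = 1 := by
    rw [Finset.sum_eq_single k] <;> simp +contextual [hw]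
  have hA : ∀ A : Mat m d, ∑ i, (∑ j, A i j * w j) ^ 2 = ∑ i, A i k ^ 2 := by
    intro A
    refine Finset.sum_congr rfl fun i _ => ?_
    rw [Finset.sum_eq_single k] <;> simp +contextual [hw]
  have hb' : (3 / 8 : ℝ) * ∑ j, w j ^ 2 < 1 / 2 := by rw [hW]; norm_num
  have hmk := mul_meas_ge_le_integral_of_nonneg (μ := gaussianMatrix m d)
    (Filter.Eventually.of_forall fun A => (Real.exp_pos _).le)
    (integrable_exp_sq_gaussianMatrix (m := m) w hb') (Real.exp (3 / 2 * m : ℝ))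
  rw [integral_exp_sq_gaussianMatrix w hb', hW] at hmk
  have hs : √(1 - 2 * (3 / 8 * 1)) = 2⁻¹ := by
    rw [show (1 - 2 * (3 / 8 * 1) : ℝ) = 2⁻¹ ^ 2 by norm_num]; exact Real.sqrt_sq (by norm_num)
  rw [hs, inv_inv] at hmk
  have hsub : {A : Mat m d | 4 * (m : ℝ) < ∑ i, A i k ^ 2}
      ⊆ {A | Real.exp (3 / 2 * m : ℝ) ≤ Real.exp (3 / 8 * ∑ i, (∑ j, A i j * w j) ^ 2)} := by
    intro A hA'
    simp only [Set.mem_ofPred_eq] at hA' ⊢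
    rw [Real.exp_le_exp, hA]
    linarith
  refine (measureReal_mono hsub).trans ?_
  have h2 : (2 : ℝ) ^ m = Real.exp (m * Real.log 2) := by
    rw [Real.exp_nat_mul, Real.exp_log (by norm_num)]
  rw [h2] at hmk
  rw [← mul_le_mul_iff_right₀ (Real.exp_pos (3 / 2 * m : ℝ))]
  refine hmk.trans ?_
  rw [← Real.exp_add, Real.exp_le_exp]
  have := Real.log_two_lt_d9
  have hm : (0 : ℝ) ≤ m := by positivity
  nlinarith

/-! ### Counting integer vectors in an `ℓ¹` ball -/

/-- Two geometric series: the sum is at most `1 + 2x/(1 - x) ≤ 1 + 4x`. -/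
lemma sum_Icc_pow_natAbs_le {x : ℝ} (hx0 : 0 ≤ x) (hx : x ≤ 1 / 2) (k : ℕ) :
    ∑ n ∈ Finset.Icc (-(k : ℤ)) k, x ^ n.natAbs ≤ Real.exp (4 * x) := by
  have h1 : ∀ k : ℕ, ∑ n ∈ Finset.Icc (-(k : ℤ)) k, x ^ n.natAbs
      = 1 + 2 * (x * ∑ i ∈ Finset.range k, x ^ i) := by
    intro k
    induction k with
    | zero => simp
    | succ k ih =>
      have e : Finset.Icc (-((k + 1 : ℕ) : ℤ)) ((k + 1 : ℕ) : ℤ)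
          = insert (-((k + 1 : ℕ) : ℤ)) (insert ((k + 1 : ℕ) : ℤ) (Finset.Icc (-(k : ℤ)) k)) := by
        ext n
        simp only [Finset.mem_Icc, Finset.mem_insert]
        omega
      rw [e, Finset.sum_insert, Finset.sum_insert, ih, Finset.sum_range_succ]
      · simp only [Int.natAbs_neg, Int.natAbs_natCast]
        ring
      · simp
      · simp only [Finset.mem_insert, Finset.mem_Icc]
        omega
  rw [h1]
  have h2 : ∑ i ∈ Finset.range k, x ^ i ≤ 2 := by
    have h3 : (∑ i ∈ Finset.range k, x ^ i) * (1 - x) = 1 - x ^ k := geom_sum_mul_neg x k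
    have h4 : 0 ≤ x ^ k := pow_nonneg hx0 k
    have h5 : 0 ≤ ∑ i ∈ Finset.range k, x ^ i := Finset.sum_nonneg fun i _ => pow_nonneg hx0 i
    nlinarith
  have := Real.add_one_le_exp (4 * x)
  nlinarith

/-- The integer vectors of `ℓ¹` norm at most `k`. -/
noncomputable def intBall (d k : ℕ) : Finset (Fin d → ℤ) :=
  (Fintype.piFinset fun _ : Fin d => Finset.Icc (-(k : ℤ)) k).filter fun z => ∑ j, |z j| ≤ (k : ℤ)

lemma mem_intBall {d k : ℕ} (z : Fin d → ℤ) : z ∈ intBall d k ↔ ∑ j, |z j| ≤ (k : ℤ) := by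
  simp only [intBall, Finset.mem_filter, Fintype.mem_piFinset, Finset.mem_Icc,
    and_iff_right_iff_imp]
  intro h j
  rw [← abs_le]
  exact (Finset.single_le_sum (fun i _ => abs_nonneg (z i)) (Finset.mem_univ j)).trans h

/-- Generating function bound: every point of the ball has weight `x^{‖z‖₁} ≥ x^k`, and the total
weight over a cube factors over coordinates. -/
lemma card_intBall_mul_pow_le {d k : ℕ} {x : ℝ} (hx0 : 0 ≤ x) (hx : x ≤ 1 / 2) :
    ((intBall d k).card : ℝ) * x ^ k ≤ Real.exp (4 * x * d) := by
  calc ((intBall d k).card : ℝ) * x ^ k = ∑ z ∈ intBall d k, x ^ k := by simp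
    _ ≤ ∑ z ∈ intBall d k, ∏ j, x ^ (z j).natAbs := by
        refine Finset.sum_le_sum fun z hz => ?_
        rw [Finset.prod_pow_eq_pow_sum]
        refine pow_le_pow_of_le_one hx0 (by linarith) ?_
        have := (mem_intBall z).1 hz
        zify
        exact this
    _ ≤ ∑ z ∈ Fintype.piFinset fun _ : Fin d => Finset.Icc (-(k : ℤ)) k,
          ∏ j, x ^ (z j).natAbs :=
        Finset.sum_le_sum_of_subset_of_nonneg (Finset.filter_subset _ _)
          fun z _ _ => Finset.prod_nonneg fun j _ => pow_nonneg hx0 _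
    _ = ∏ _j : Fin d, ∑ n ∈ Finset.Icc (-(k : ℤ)) k, x ^ n.natAbs :=
        (Finset.prod_univ_sum (fun _ : Fin d => Finset.Icc (-(k : ℤ)) k)
          fun _ n => x ^ n.natAbs).symm
    _ ≤ ∏ _j : Fin d, Real.exp (4 * x) :=
        Finset.prod_le_prod (fun j _ => Finset.sum_nonneg fun n _ => pow_nonneg hx0 _)
          fun j _ => sum_Icc_pow_natAbs_le hx0 hx k
    _ = Real.exp (4 * x * d) := by
        rw [Finset.prod_const, Finset.card_univ, Fintype.card_fin, ← Real.exp_nat_mul]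
        ring_nf

/-! ### Gaussian matrices are good for sparse recovery -/

lemma measurableSet_isGoodMatrix (m d s : ℕ) : MeasurableSet {A : Mat m d | IsGoodMatrix s A} := by
  have e : {A : Mat m d | IsGoodMatrix s A}
      = (⋂ z : Fin d → ℤ, {A | ∑ j, |z j| ≤ ((128 * s + 1 : ℕ) : ℤ) →
          (m : ℝ) / 4 * ∑ j, (z j : ℝ) ^ 2 ≤ ∑ i, (∑ j, A i j * (z j : ℝ)) ^ 2})
        ∩ ⋂ j, {A | ∑ i, A i j ^ 2 ≤ 4 * (m : ℝ)} := by
    ext A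
    simp only [Set.mem_ofPred_eq, Set.mem_inter_iff, Set.mem_iInter]
    exact ⟨fun h => ⟨h.1, h.2⟩, fun h => ⟨h.1, h.2⟩⟩
  rw [e]
  refine (MeasurableSet.iInter fun z => ?_).inter (MeasurableSet.iInter fun j => ?_)
  · by_cases hz : ∑ j, |z j| ≤ ((128 * s + 1 : ℕ) : ℤ)
    · simp only [hz, true_imp_iff]
      exact measurableSet_le (by fun_prop) (by fun_prop)
    · simp only [hz, false_imp_iff]
      exact MeasurableSet.const _
  · exact measurableSet_le (by fun_prop) (by fun_prop)

lemma gaussianMatrix_not_good_le (m d s : ℕ) :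
    (gaussianMatrix m d).real {A | ¬ IsGoodMatrix s A}
      ≤ ((intBall d (128 * s + 1)).card + d) * Real.exp (-(m / 4 : ℝ)) := by
  have hsub : {A : Mat m d | ¬ IsGoodMatrix s A}
      ⊆ (⋃ z ∈ intBall d (128 * s + 1),
          {A | ∑ i, (∑ j, A i j * (z j : ℝ)) ^ 2 < (m : ℝ) / 4 * ∑ j, (z j : ℝ) ^ 2})
        ∪ ⋃ j ∈ (Finset.univ : Finset (Fin d)), {A | 4 * (m : ℝ) < ∑ i, A i j ^ 2} := by
    intro A hA
    by_contra hcon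
    simp only [Set.mem_union, Set.mem_iUnion, Set.mem_ofPred_eq, not_or, not_exists, not_lt,
      Finset.mem_univ, true_imp_iff] at hcon
    exact hA ⟨fun z hz => hcon.1 z ((mem_intBall z).2 hz), fun j => hcon.2 j⟩
  refine (measureReal_mono hsub).trans ((measureReal_union_le _ _).trans ?_)
  rw [add_mul]
  gcongr
  · refine (measureReal_biUnion_finset_le _ _).trans ?_
    refine (Finset.sum_le_sum fun z _ => gaussianMatrix_lower_tail _).trans ?_
    simp
  · refine (measureReal_biUnion_finset_le _ _).trans ?_
    refine (Finset.sum_le_sum fun j _ => gaussianMatrix_column_tail j).trans ?_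
    simp

/-- Since `s ≤ d`, the argument is at least `e/2`, and `1 - log 2 > 3/10`. This lets additive
constants be absorbed into the logarithm. -/
lemma log_sparsity_ge {d s : ℕ} (hs : 1 ≤ s) (hsd : s ≤ d) :
    3 / 10 ≤ Real.log (Real.exp 1 * d / (2 * s)) := by
  have hs' : (0 : ℝ) < s := by exact_mod_cast hs
  have hsd' : (s : ℝ) ≤ d := by exact_mod_cast hsd
  have h : Real.exp 1 / 2 ≤ Real.exp 1 * d / (2 * s) := by
    rw [div_le_div_iff₀ (by norm_num) (by positivity)]
    have := Real.exp_pos 1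
    nlinarith
  have h2 := Real.log_le_log (by positivity) h
  rw [Real.log_div (by positivity) (by norm_num), Real.log_exp] at h2
  have := Real.log_two_lt_d9
  linarith

/-- The count is taken at `x = s/(2d)`, giving `exp(2s + (128s + 1) log(2d/s))` points. The factor
`800` makes `m/4` exceed that exponent by at least `log(4T)`. -/
lemma gaussianMatrix_not_good_le_inv {m d s T : ℕ} (hs : 1 ≤ s) (hsd : s ≤ d) (hT : 1 ≤ T)
    (hm : 800 * (2 * s * Real.log (Real.exp 1 * d / (2 * s)) + Real.log (4 * T)) ≤ m) :
    (gaussianMatrix m d).real {A | ¬ IsGoodMatrix s A} ≤ 1 / T := by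
  refine (gaussianMatrix_not_good_le m d s).trans ?_
  have hs' : (1 : ℝ) ≤ s := by exact_mod_cast hs
  have hsd' : (s : ℝ) ≤ d := by exact_mod_cast hsd
  have hT' : (1 : ℝ) ≤ T := by exact_mod_cast hT
  have hd' : (0 : ℝ) < d := by linarith
  have hs0 : (0 : ℝ) < s := by linarith
  set ℓ := Real.log (Real.exp 1 * d / (2 * s)) with hℓ
  have hℓ0 := log_sparsity_ge hs hsd
  rw [← hℓ] at hℓ0
  set lam := Real.log (2 * d / s) with hlam
  have hlamℓ : lam ≤ 23 / 10 * ℓ := by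
    have e : lam = ℓ + 2 * Real.log 2 - 1 := by
      rw [hlam, hℓ, Real.log_div (by positivity) (by positivity),
        Real.log_div (by positivity) (by positivity), Real.log_mul (by positivity) (by positivity),
        Real.log_mul (by positivity) (by positivity), Real.log_mul (by positivity) (by positivity),
        Real.log_exp]
      ring
    have := Real.log_two_lt_d9
    linarith
  have hlam0 : 0 ≤ lam := Real.log_nonneg (by rw [le_div_iff₀ hs0]; linarith)
  have hexp : Real.exp lam = 2 * d / s := Real.exp_log (by positivity)
  have hN : ((intBall d (128 * s + 1)).card : ℝ)
      ≤ Real.exp (2 * s + (128 * s + 1 : ℕ) * lam) := by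
    have h := card_intBall_mul_pow_le (d := d) (k := 128 * s + 1) (x := s / (2 * d))
      (by positivity) (by rw [div_le_div_iff₀ (by positivity) (by norm_num)]; linarith)
    have e1 : (s : ℝ) / (2 * d) = Real.exp (-lam) := by
      rw [Real.exp_neg, hexp, inv_div]
    have e2 : 4 * ((s : ℝ) / (2 * d)) * d = 2 * s := by field_simp; ring
    rw [e2, e1, ← Real.exp_nat_mul] at h
    rw [Real.exp_add]
    have : ((128 * s + 1 : ℕ) : ℝ) * lam = -((128 * s + 1 : ℕ) * -lam) := by ring
    rw [this, Real.exp_neg, ← div_eq_mul_inv, le_div_iff₀ (Real.exp_pos _)]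
    exact h
  have hd : (d : ℝ) ≤ Real.exp (2 * s + (128 * s + 1 : ℕ) * lam) := by
    have h1 : (d : ℝ) ≤ Real.exp (s + lam) := by
      rw [Real.exp_add, hexp]
      have h2 : (s : ℝ) ≤ Real.exp s := by linarith [Real.add_one_le_exp (s : ℝ)]
      calc (d : ℝ) ≤ s * (2 * d / s) := by field_simp; linarith
        _ ≤ _ := by gcongr
    refine h1.trans (Real.exp_le_exp.2 ?_)
    push_cast
    nlinarith
  have hbound : 2 * (s : ℝ) + (128 * s + 1 : ℕ) * lam ≤ 200 * (2 * s * ℓ) := by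
    push_cast
    have h1 : (128 * (s : ℝ) + 1) * lam ≤ 129 * s * (23 / 10 * ℓ) := by
      have : (128 * (s : ℝ) + 1) ≤ 129 * s := by linarith
      gcongr
    nlinarith
  calc (((intBall d (128 * s + 1)).card : ℝ) + d) * Real.exp (-(m / 4 : ℝ))
      ≤ (2 * Real.exp (200 * (2 * s * ℓ))) * Real.exp (-(m / 4 : ℝ)) := by
        have := Real.exp_le_exp.2 hbound
        gcongr
        linarith
    _ = 2 * Real.exp (200 * (2 * s * ℓ) - m / 4) := by
        rw [sub_eq_add_neg, Real.exp_add]; ring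
    _ ≤ 2 * Real.exp (-Real.log (4 * T)) := by
        have h4 : 0 ≤ Real.log (4 * T) := Real.log_nonneg (by linarith)
        gcongr
        linarith
    _ ≤ 1 / T := by
        rw [Real.exp_neg, Real.exp_log (by positivity), ← div_eq_mul_inv,
          div_le_div_iff₀ (by positivity) (by positivity)]
        linarith

/-! ### Admissible cost functions -/

namespace Admissible

variable {d s : ℕ} {K : Set (Vec d)} {Lf L : ℝ} {f : Vec d → ℝ}

lemma hasFDerivAt (hf : Admissible K Lf L s f) (x : Vec d) :
    HasFDerivAt f (innerSL ℝ (gradient f x)) x :=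
  (hf.differentiable x).hasGradientAt.hasFDerivAt

lemma continuous (hf : Admissible K Lf L s f) : Continuous f := hf.differentiable.continuous

lemma norm_gradient_le (hf : Admissible K Lf L s f) (hLf : 0 ≤ Lf) (x : Vec d) :
    ‖gradient f x‖ ≤ Lf := by
  have hlip : LipschitzWith Lf.toNNReal f := LipschitzWith.of_dist_le_mul fun x y => by
    rw [Real.dist_eq, dist_eq_norm, Real.coe_toNNReal _ hLf]
    exact hf.lipschitz x y
  have := (hf.hasFDerivAt x).le_of_lipschitz hlip
  rwa [innerSL_apply_norm, Real.coe_toNNReal _ hLf] at this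

/-- The mean value inequality on the segment gives `L` instead of the sharp `L/2`; the tube radius
`3Lδ` leaves room for this. -/
lemma abs_taylor_le (hf : Admissible K Lf L s f) (hL : 0 ≤ L) (x h : Vec d) :
    |f (x + h) - f x - inner ℝ (gradient f x) h| ≤ L * ‖h‖ ^ 2 := by
  have key := (convex_segment x (x + h)).norm_image_sub_le_of_norm_hasFDerivWithin_le'
    (f := f) (f' := fun z => innerSL ℝ (gradient f z)) (φ := innerSL ℝ (gradient f x))
    (C := L * ‖h‖) (fun z _ => (hf.hasFDerivAt z).hasFDerivWithinAt)
    (fun z hz => by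
      rw [← map_sub, innerSL_apply_norm]
      refine (hf.smooth z x).trans (mul_le_mul_of_nonneg_left ?_ hL)
      simpa [norm_sub_rev] using norm_sub_le_of_mem_segment hz)
    (left_mem_segment ℝ _ _) (right_mem_segment ℝ _ _)
  rw [add_sub_cancel_left] at key
  rw [Real.norm_eq_abs] at key
  refine (le_of_eq ?_).trans (key.trans_eq (by ring))
  simp

lemma sub_le_inner (hf : Admissible K Lf L s f) (x u : Vec d) :
    f x - f u ≤ inner ℝ (gradient f x) (x - u) := by
  set g : ℝ → ℝ := fun t => f (AffineMap.lineMap x u t) with hg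
  have hconv : ConvexOn ℝ Set.univ g := by
    have := hf.convex.comp_affineMap (AffineMap.lineMap x u : ℝ →ᵃ[ℝ] Vec d)
    rw [Set.preimage_univ] at this
    exact this
  have hder : HasDerivAt g (inner ℝ (gradient f x) (u - x)) 0 := by
    have h1 : HasFDerivAt f (innerSL ℝ (gradient f x)) (AffineMap.lineMap x u (0 : ℝ)) := by
      simpa using hf.hasFDerivAt x
    have h2 : HasDerivAt (fun t : ℝ => AffineMap.lineMap x u t) (u - x) 0 :=
      AffineMap.hasDerivAt_lineMap
    exact h1.comp_hasDerivAt (0 : ℝ) h2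
  have := hconv.le_slope_of_hasDerivAt (Set.mem_univ 0) (Set.mem_univ 1) one_pos hder
  rw [slope_def_field] at this
  simp only [hg, AffineMap.lineMap_apply_one, AffineMap.lineMap_apply_zero, sub_zero,
    div_one] at this
  rw [← neg_sub u x, inner_neg_right]
  linarith

end Admissible

/-! ### The measurement vector -/

/-- The off-diagonal part of `⟨b, Δ⟩ Δ_i`. -/
def crossTerm {m : ℕ} (b : Fin m → ℝ) (i : Fin m) (Δ : Fin m → ℝ) : ℝ :=
  ∑ j ∈ Finset.univ.erase i, b j * (Δ j * Δ i)

/-- The vector `A v`. -/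
def apply {m d : ℕ} (A : Mat m d) (v : Vec d) : Fin m → ℝ := fun i => ∑ j, A i j * v j

lemma inner_rowCombination {m d : ℕ} (A : Mat m d) (v : Vec d) (Δ : Fin m → ℝ) :
    inner ℝ v (rowCombination A Δ) = ∑ i, apply A v i * Δ i := by
  simp only [rowCombination, apply, PiLp.inner_apply, RCLike.inner_apply, conj_trivial,
    Finset.sum_mul]
  rw [Finset.sum_comm]
  exact Finset.sum_congr rfl fun i _ => Finset.sum_congr rfl fun j _ => by ring

lemma sum_mul_sign {m : ℕ} (b : Fin m → ℝ) (i : Fin m) {Δ : Fin m → ℝ} (hΔ : |Δ i| = 1) :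
    (∑ j, b j * Δ j) * Δ i = b i + crossTerm b i Δ := by
  have h : Δ i * Δ i = 1 := by rw [← abs_mul_abs_self, hΔ, one_mul]
  rw [crossTerm, Finset.sum_mul, ← Finset.add_sum_erase _ _ (Finset.mem_univ i), mul_assoc, h,
    mul_one]
  simp_rw [mul_assoc]

/-- With `u = AᵀΔ` the step `t = δ/‖u‖²` satisfies `t²‖u‖² = tδ`, so after division by `t` the
Taylor error is `Lδ` whatever the size of `u`. -/
lemma abs_difference_quotient_sub_le {m d s : ℕ} {K : Set (Vec d)} {Lf L δ : ℝ} {f : Vec d → ℝ}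
    (hf : Admissible K Lf L s f) (hL : 0 ≤ L) (hδ : 0 < δ) (A : Mat m d) (x : Vec d) (i : Fin m)
    {Δ : Fin m → ℝ} (hΔ : |Δ i| = 1) :
    |(f (perturbed δ A x Δ) - f x) / (stepScale δ A Δ * Δ i)
      - (apply A (gradient f x) i + crossTerm (apply A (gradient f x)) i Δ)| ≤ L * δ := by
  rw [← sum_mul_sign _ i hΔ, ← inner_rowCombination]
  set u := rowCombination A Δ with hu
  have hii : Δ i * Δ i = 1 := by rw [← abs_mul_abs_self, hΔ, one_mul]
  -- When `AᵀΔ = 0` the step scale is `δ/0 = 0` and the quotient is `0/0 = 0`, which is also the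
  -- value of the linear term.
  by_cases h0 : u = 0
  · have : stepScale δ A Δ = 0 := by simp [stepScale, ← hu, h0]
    rw [this, h0]
    simp
    positivity
  have hun : 0 < ‖u‖ := norm_pos_iff.2 h0
  set t := stepScale δ A Δ with ht
  have ht' : t = δ / ‖u‖ ^ 2 := rfl
  have htpos : 0 < t := by rw [ht']; positivity
  have hT := hf.abs_taylor_le hL x (t • u)
  rw [inner_smul_right, norm_smul, Real.norm_of_nonneg htpos.le] at hT
  have e2 : (t * ‖u‖) ^ 2 = t * δ := by rw [ht']; field_simp
  rw [e2] at hT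
  have hne : Δ i ≠ 0 := by intro h; simp [h] at hΔ
  have e1 : (f (perturbed δ A x Δ) - f x) / (t * Δ i) - inner ℝ (gradient f x) u * Δ i
      = (f (x + t • u) - f x - t * inner ℝ (gradient f x) u) * (Δ i / t) := by
    have : perturbed δ A x Δ = x + t • u := rfl
    rw [this]
    field_simp
    rw [pow_two, hii]; ring
  rw [e1, abs_mul, abs_div, hΔ, abs_of_pos htpos, ← div_eq_mul_one_div, div_le_iff₀ htpos]
  linarith

/-- One `Lδ` comes from the Taylor errors and one from the averaged cross terms. -/
lemma abs_measurement_sub_le {m d s k : ℕ} {K : Set (Vec d)} {Lf L δ : ℝ} {f : Vec d → ℝ}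
    (hf : Admissible K Lf L s f) (hL : 0 ≤ L) (hδ : 0 < δ) (hk : 1 ≤ k) (ξ : Seed m d)
    (x : Vec d) (i : Fin m) (hξ : ∀ l, |ξ.2 l i| = 1)
    (hc : |∑ l ∈ Finset.range k, crossTerm (apply ξ.1 (gradient f x)) i (ξ.2 l)| ≤ k * (L * δ)) :
    |measurement δ k f ξ x i - apply ξ.1 (gradient f x) i| ≤ 2 * (L * δ) := by
  have hk' : (0 : ℝ) < k := by exact_mod_cast hk
  set b := apply ξ.1 (gradient f x) with hb
  set q : ℕ → ℝ := fun l =>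
    (f (perturbed δ ξ.1 x (ξ.2 l)) - f x) / (stepScale δ ξ.1 (ξ.2 l) * ξ.2 l i) with hq
  have hm : measurement δ k f ξ x i = 1 / (k : ℝ) * ∑ l ∈ Finset.range k, q l := rfl
  have hsum : |∑ l ∈ Finset.range k, (q l - (b i + crossTerm b i (ξ.2 l)))| ≤ k * (L * δ) := by
    refine (Finset.abs_sum_le_sum_abs _ _).trans ?_
    refine (Finset.sum_le_sum fun l _ =>
      abs_difference_quotient_sub_le hf hL hδ ξ.1 x i (hξ l)).trans ?_
    simp
  rw [Finset.sum_sub_distrib, Finset.sum_add_distrib, Finset.sum_const, Finset.card_range,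
    nsmul_eq_mul] at hsum
  have e : measurement δ k f ξ x i - b i = (∑ l ∈ Finset.range k, q l - k * b i) / k := by
    rw [hm]; field_simp
  rw [e, abs_div, abs_of_pos hk', div_le_iff₀ hk']
  rw [abs_le] at hsum hc ⊢
  constructor <;> linarith [hsum.1, hsum.2, hc.1, hc.2]

/-- The rescaling by `1/√m` turns a coordinatewise bound into a Euclidean bound with the same
constant, so the tube radius need not grow with `m`. -/
lemma norm_toLp_le {m : ℕ} (hm : 0 < m) (w : Fin m → ℝ) {c : ℝ} (hc : 0 ≤ c)
    (hw : ∀ i, |w i| ≤ c) : ‖((1 / √(m : ℝ)) • WithLp.toLp 2 w : Vec m)‖ ≤ c := by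
  have hm' : (0 : ℝ) < m := by exact_mod_cast hm
  refine abs_le_of_sq_le_sq' ?_ hc |>.2
  rw [norm_smul, mul_pow, EuclideanSpace.real_norm_sq_eq, Real.norm_of_nonneg (by positivity),
    div_pow, Real.sq_sqrt hm'.le, one_pow, one_div, inv_mul_le_iff₀ hm']
  calc ∑ i, (WithLp.toLp 2 w : Vec m) i ^ 2 ≤ ∑ _i : Fin m, c ^ 2 :=
        Finset.sum_le_sum fun i _ => sq_le_sq' (abs_le.1 (hw i)).1 (abs_le.1 (hw i)).2
    _ = m * c ^ 2 := by simp

/-- The draws `ξ` of a round are good for the gradient `v`. -/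
structure IsGoodSeed {m d : ℕ} (s : ℕ) (Lf L δ : ℝ) (T : ℕ) (v : Vec d) (ξ : Seed m d) :
    Prop where
  matrix : IsGoodMatrix s ξ.1
  sign : ∀ l i, |ξ.2 l i| = 1
  cross : ∀ i, |∑ l ∈ Finset.range (repetitions Lf L δ T ξ.1), crossTerm (apply ξ.1 v) i (ξ.2 l)|
    ≤ repetitions Lf L δ T ξ.1 * (L * δ)

lemma one_le_repetitions {m d : ℕ} (Lf L δ : ℝ) (T : ℕ) (A : Mat m d) :
    1 ≤ repetitions Lf L δ T A := le_max_left _ _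

/-- This holds for every draw, so it also caps the damage of a failed round. -/
lemma norm_gradEstimate_le {m d : ℕ} {τ ρ δ : ℝ} (hρ : 0 ≤ ρ) {rec : Mat m d → Vec m → Vec d}
    (hrec : IsBasisPursuit τ ρ rec) (k : ℕ) (f : Vec d → ℝ) (ξ : Seed m d) (x : Vec d) :
    ‖gradEstimate rec δ k f ξ x‖ ≤ ρ := by
  rw [gradEstimate]
  set B : Mat m d := fun i j => 1 / √(m : ℝ) * ξ.1 i j
  set y := (1 / √(m : ℝ)) • measurement δ k f ξ x
  rcases (feasible τ ρ B y).eq_empty_or_nonempty with h | h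
  · rw [hrec.infeasible _ _ h]; simpa
  · exact (hrec.mem _ _ h).2

/-- The measurement error `2Lδ` makes the true gradient feasible; the minimizer then has no larger
`ℓ¹` norm and stable recovery applies with `τ = 3Lδ`. -/
lemma IsGoodSeed.norm_gradEstimate_sub_le {m d s T : ℕ} {K : Set (Vec d)} {Lf L δ : ℝ}
    (hs : 1 ≤ s) (hm : 0 < m) (hLf : 0 ≤ Lf) (hL : 0 ≤ L) (hδ : 0 < δ)
    {rec : Mat m d → Vec m → Vec d}
    (hrec : IsBasisPursuit (3 * L * δ) (Lf + 3 * L * δ) rec) {f : Vec d → ℝ}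
    (hf : Admissible K Lf L s f) {x : Vec d} (hx : x ∈ K) {ξ : Seed m d}
    (hξ : IsGoodSeed s Lf L δ T (gradient f x) ξ) :
    ‖gradEstimate rec δ (repetitions Lf L δ T ξ.1) f ξ x - gradient f x‖ ≤ 6 * (3 * L * δ) := by
  set k := repetitions Lf L δ T ξ.1
  set v := gradient f x
  have hLδ : 0 ≤ L * δ := by positivity
  have hv : v ∈ feasible (3 * L * δ) (Lf + 3 * L * δ) (fun i j => 1 / √(m : ℝ) * ξ.1 i j)
      ((1 / √(m : ℝ)) • measurement δ k f ξ x) := by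
    refine ⟨?_, (hf.norm_gradient_le hLf x).trans (by linarith)⟩
    have e : (WithLp.toLp 2 fun i => ∑ j, 1 / √(m : ℝ) * ξ.1 i j * v j : Vec m)
        - (1 / √(m : ℝ)) • measurement δ k f ξ x
        = (1 / √(m : ℝ)) • (WithLp.toLp 2 fun i => apply ξ.1 v i - measurement δ k f ξ x i) := by
      ext i
      simp [apply, mul_sub, Finset.mul_sum, mul_assoc]
    rw [e]
    refine (norm_toLp_le hm _ (by positivity : 0 ≤ 2 * (L * δ)) fun i => ?_).trans (by linarith)
    rw [abs_sub_comm]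
    exact abs_measurement_sub_le hf hL hδ (one_le_repetitions _ _ _ _ _) ξ x i
      (fun l => hξ.sign l i) (hξ.cross i)
  exact hξ.matrix.dist_le hs hm (hf.sparse x hx) (hrec.minimal _ _ v hv) hv
    (hrec.mem _ _ ⟨v, hv⟩)

/-! ### Random signs -/

/-- The law of a sequence of independent uniform sign vectors. -/
noncomputable def signLaw (m : ℕ) : Measure (ℕ → Fin m → ℝ) :=
  Measure.infinitePi fun _ : ℕ => Measure.pi fun _ => rademacher

instance (m : ℕ) : IsProbabilityMeasure (signLaw m) := by
  unfold signLaw; infer_instance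

lemma seedLaw_eq (m d : ℕ) : seedLaw m d = (gaussianMatrix m d).prod (signLaw m) := rfl

lemma measurePreserving_eval_signLaw (m l : ℕ) :
    MeasurePreserving (fun σ : ℕ → Fin m → ℝ => σ l) (signLaw m)
      (Measure.pi fun _ => rademacher) :=
  measurePreserving_eval_infinitePi _ l

lemma ae_rademacher_abs : ∀ᵐ x ∂rademacher, |x| = 1 := by
  have hS : MeasurableSet {x : ℝ | ¬ |x| = 1} :=
    ((measurableSet_singleton (1 : ℝ)).preimage (by fun_prop : Measurable fun x : ℝ => |x|)).compl
  rw [ae_iff, rademacher, Measure.add_apply, Measure.smul_apply, Measure.smul_apply,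
    Measure.dirac_apply' _ hS, Measure.dirac_apply' _ hS]
  simp

lemma integral_id_rademacher : ∫ x, x ∂rademacher = 0 := by
  rw [rademacher, integral_add_measure, integral_smul_measure, integral_smul_measure]
  · simp
  · exact (integrable_dirac (by simp)).smul_measure (by simp)
  · exact (integrable_dirac (by simp)).smul_measure (by simp)

lemma ae_pi_rademacher_abs (m : ℕ) :
    ∀ᵐ Δ ∂(Measure.pi fun _ : Fin m => rademacher), ∀ i, |Δ i| = 1 := by
  rw [ae_all_iff]
  intro i
  exact (measurePreserving_eval (fun _ : Fin m => rademacher) i).quasiMeasurePreserving.ae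
    ae_rademacher_abs

lemma ae_signLaw_abs (m : ℕ) : ∀ᵐ σ ∂(signLaw m), ∀ l i, |σ l i| = 1 := by
  rw [ae_all_iff]
  intro l
  exact (measurePreserving_eval_signLaw m l).quasiMeasurePreserving.ae (ae_pi_rademacher_abs m)

lemma measurable_crossTerm {m : ℕ} (b : Fin m → ℝ) (i : Fin m) : Measurable (crossTerm b i) := by
  unfold crossTerm; fun_prop

lemma abs_crossTerm_le {m : ℕ} {b : Fin m → ℝ} {β : ℝ} (hb : ∀ j, |b j| ≤ β) (i : Fin m)
    {Δ : Fin m → ℝ} (hΔ : ∀ j, |Δ j| = 1) : |crossTerm b i Δ| ≤ ((m : ℝ) - 1) * β := by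
  have hm : 1 ≤ m := i.pos
  refine (Finset.abs_sum_le_sum_abs _ _).trans ?_
  calc ∑ j ∈ Finset.univ.erase i, |b j * (Δ j * Δ i)| ≤ ∑ j ∈ Finset.univ.erase i, β :=
        Finset.sum_le_sum fun j _ => by
          rw [abs_mul, abs_mul, hΔ, hΔ]; simpa using hb j
    _ = ((m : ℝ) - 1) * β := by
        rw [Finset.sum_const, Finset.card_erase_of_mem (Finset.mem_univ i), Finset.card_univ,
          Fintype.card_fin, nsmul_eq_mul, Nat.cast_sub hm, Nat.cast_one]

/-- Each summand is a product of two distinct, hence independent, centred signs. -/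
lemma integral_crossTerm {m : ℕ} (b : Fin m → ℝ) (i : Fin m) :
    ∫ Δ, crossTerm b i Δ ∂(Measure.pi fun _ : Fin m => rademacher) = 0 := by
  have hind : iIndepFun (fun (j : Fin m) (Δ : Fin m → ℝ) => Δ j)
      (Measure.pi fun _ : Fin m => rademacher) :=
    iIndepFun_pi (X := fun (_ : Fin m) (x : ℝ) => x) (fun _ => by fun_prop)
  have hint : ∀ j k : Fin m, Integrable (fun Δ : Fin m → ℝ => Δ j * Δ k)
      (Measure.pi fun _ : Fin m => rademacher) := by
    intro j k
    refine Integrable.of_bound (Measurable.aestronglyMeasurable (by fun_prop)) 1 ?_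
    filter_upwards [ae_pi_rademacher_abs m] with Δ hΔ
    simp [hΔ]
  unfold crossTerm
  rw [integral_finsetSum _ fun j _ => (hint j i).const_mul _]
  refine Finset.sum_eq_zero fun j hj => ?_
  rw [integral_const_mul, (hind.indepFun (Finset.ne_of_mem_erase hj)).integral_fun_mul_eq_mul_integral
    (Measurable.aestronglyMeasurable (by fun_prop)) (Measurable.aestronglyMeasurable (by fun_prop))]
  have : ∫ Δ : Fin m → ℝ, Δ j ∂(Measure.pi fun _ : Fin m => rademacher) = 0 := by
    rw [integral_comp_eval (μ := fun _ : Fin m => rademacher) (i := j) (f := fun x : ℝ => x)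
      (Measurable.aestronglyMeasurable (by fun_prop))]
    exact integral_id_rademacher
  rw [this]; simp

/-- Hoeffding's inequality for the averaged off-diagonal terms. -/
lemma signLaw_crossTerm_tail {m : ℕ} {b : Fin m → ℝ} {β ε : ℝ} (hb : ∀ j, |b j| ≤ β)
    (hε : 0 ≤ ε) (i : Fin m) (k : ℕ) :
    (signLaw m).real {σ | k * ε < |∑ l ∈ Finset.range k, crossTerm b i (σ l)|}
      ≤ 2 * Real.exp (-(k * ε) ^ 2 / (2 * k * (((m : ℝ) - 1) * β) ^ 2)) := by
  have hm : (1 : ℝ) ≤ m := by exact_mod_cast i.pos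
  have hβ : 0 ≤ β := (abs_nonneg _).trans (hb i)
  set B := ((m : ℝ) - 1) * β with hB
  have hB0 : 0 ≤ B := mul_nonneg (by linarith) hβ
  have hmeas := measurable_crossTerm b i
  have hind : iIndepFun (fun (l : ℕ) (σ : ℕ → Fin m → ℝ) => crossTerm b i (σ l)) (signLaw m) :=
    iIndepFun_infinitePi (X := fun (_ : ℕ) (Δ : Fin m → ℝ) => crossTerm b i Δ) fun _ => hmeas
  have hsub : ∀ l, HasSubgaussianMGF (fun σ : ℕ → Fin m → ℝ => crossTerm b i (σ l))
      ((‖B - -B‖₊ / 2) ^ 2) (signLaw m) := by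
    intro l
    refine hasSubgaussianMGF_of_mem_Icc_of_integral_eq_zero
      (hmeas.comp (measurable_pi_apply l)).aemeasurable ?_ ?_
    · filter_upwards [ae_signLaw_abs m] with σ hσ
      exact abs_le.1 (abs_crossTerm_le hb i (hσ l))
    · rw [← integral_crossTerm b i, ← (measurePreserving_eval_signLaw m l).map_eq,
        integral_map (measurable_pi_apply l).aemeasurable hmeas.aestronglyMeasurable]
  -- The cross term lies in `[-B, B]`, so Hoeffding's lemma gives variance proxy `(2B/2)² = B²`.
  have hc : (((‖B - -B‖₊ / 2) ^ 2 : NNReal) : ℝ) = B ^ 2 := by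
    push_cast
    rw [Real.norm_of_nonneg (by linarith)]
    ring
  have hkε : 0 ≤ k * ε := by positivity
  have h1 := HasSubgaussianMGF.measure_sum_range_ge_le_of_iIndepFun hind (n := k)
    (fun l _ => hsub l) hkε
  have hindn : iIndepFun (fun (l : ℕ) (σ : ℕ → Fin m → ℝ) => -crossTerm b i (σ l)) (signLaw m) :=
    iIndepFun_infinitePi (X := fun (_ : ℕ) (Δ : Fin m → ℝ) => -crossTerm b i Δ) fun _ => hmeas.neg
  have h2 := HasSubgaussianMGF.measure_sum_range_ge_le_of_iIndepFun hindn (n := k) (fun l _ => (hsub l).neg) hkε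
  rw [hc] at h1 h2
  refine (measureReal_mono (s₂ := {σ | k * ε ≤ ∑ l ∈ Finset.range k, crossTerm b i (σ l)}
    ∪ {σ | k * ε ≤ ∑ l ∈ Finset.range k, -crossTerm b i (σ l)}) ?_ (measure_ne_top _ _)).trans
    ((measureReal_union_le _ _).trans ?_)
  · intro σ hσ
    simp only [Set.mem_ofPred_eq, Set.mem_union, Finset.sum_neg_distrib] at hσ ⊢
    rcases lt_abs.1 hσ with h | h
    · exact Or.inl h.le
    · exact Or.inr h.le
  · linarith

/-! ### A round is good with high probability -/

/-- The largest Euclidean norm of a row. -/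
noncomputable def maxRowNorm {m d : ℕ} (A : Mat m d) : ℝ := ⨆ i, ‖(WithLp.toLp 2 (A i) : Vec d)‖

lemma norm_row_le {m d : ℕ} (A : Mat m d) (i : Fin m) :
    ‖(WithLp.toLp 2 (A i) : Vec d)‖ ≤ maxRowNorm A :=
  le_ciSup (f := fun i => ‖(WithLp.toLp 2 (A i) : Vec d)‖) (Set.finite_range _).bddAbove i

lemma abs_apply_le {m d : ℕ} (A : Mat m d) (v : Vec d) (i : Fin m) :
    |apply A v i| ≤ ‖v‖ * maxRowNorm A := by
  have e : apply A v i = inner ℝ v (WithLp.toLp 2 (A i) : Vec d) := by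
    simp [apply, PiLp.inner_apply]
  rw [e]
  exact (abs_real_inner_le_norm _ _).trans
    (mul_le_mul_of_nonneg_left (norm_row_le A i) (norm_nonneg v))

lemma repetitions_eq {m d : ℕ} {Lf L δ : ℝ} {T : ℕ} (hm : 0 < m) (A : Mat m d) :
    repetitions Lf L δ T A = max 1 ⌈2 * (((m : ℝ) - 1) * (Lf * maxRowNorm A)) ^ 2 / (L * δ) ^ 2
      * Real.log (2 * m * T)⌉₊ := by
  have hm' : (0 : ℝ) < m := by exact_mod_cast hm
  unfold repetitions
  simp only []
  rw [← maxRowNorm]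
  congr 3
  rw [mul_pow, Real.sq_sqrt hm'.le]
  by_cases h : L * δ = 0
  · rcases mul_eq_zero.1 h with h2 | h2 <;> simp [h2]
  · have h2 : L ≠ 0 ∧ δ ≠ 0 := mul_ne_zero_iff.1 h
    obtain ⟨h3, h4⟩ := h2
    field_simp

/-- The number of repetitions makes the Hoeffding exponent at least `log(2mT)`, so each coordinate
fails with probability at most `1/(mT)`; a union bound over `m` coordinates follows. -/
lemma signLaw_not_cross_le {m d T : ℕ} {Lf L δ : ℝ} (hT : 1 ≤ T) (hLδ : 0 < L * δ)
    (A : Mat m d) {v : Vec d} (hv : ‖v‖ ≤ Lf) :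
    (signLaw m).real {σ | ¬ ∀ i,
      |∑ l ∈ Finset.range (repetitions Lf L δ T A), crossTerm (apply A v) i (σ l)|
        ≤ repetitions Lf L δ T A * (L * δ)} ≤ 1 / T := by
  have hT' : (1 : ℝ) ≤ T := by exact_mod_cast hT
  rcases Nat.eq_zero_or_pos m with rfl | hm
  · simp
  have hm' : (1 : ℝ) ≤ m := by exact_mod_cast hm
  set k := repetitions Lf L δ T A with hk
  have hk1 : 1 ≤ k := one_le_repetitions _ _ _ _ _
  have hk' : (0 : ℝ) < k := by exact_mod_cast hk1
  have hk2 : 2 * (((m : ℝ) - 1) * (Lf * maxRowNorm A)) ^ 2 / (L * δ) ^ 2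
      * Real.log (2 * m * T) ≤ k := by
    rw [hk, repetitions_eq hm]
    exact (Nat.le_ceil _).trans (by exact_mod_cast le_max_right _ _)
  set B := ((m : ℝ) - 1) * (Lf * maxRowNorm A) with hB
  have hb : ∀ j, |apply A v j| ≤ Lf * maxRowNorm A := fun j =>
    (abs_apply_le A v j).trans (mul_le_mul_of_nonneg_right hv
      ((norm_nonneg _).trans (norm_row_le A j)))
  have htail : ∀ i, (signLaw m).real
      {σ | k * (L * δ) < |∑ l ∈ Finset.range k, crossTerm (apply A v) i (σ l)|}
      ≤ 1 / (m * T) := by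
    intro i
    -- If `B = 0` (for instance when `m = 1`) the Hoeffding exponent has denominator zero and says
    -- nothing, but the cross terms vanish almost surely.
    by_cases hB0 : B = 0
    · have hz : (signLaw m).real
          {σ | k * (L * δ) < |∑ l ∈ Finset.range k, crossTerm (apply A v) i (σ l)|} = 0 := by
        rw [measureReal_eq_zero_iff, ← nonpos_iff_eq_zero]
        have hae : ∀ᵐ σ ∂(signLaw m),
            ¬ k * (L * δ) < |∑ l ∈ Finset.range k, crossTerm (apply A v) i (σ l)| := by
          filter_upwards [ae_signLaw_abs m] with σ hσ
          have h0 : ∀ l, crossTerm (apply A v) i (σ l) = 0 := fun l => by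
            have := abs_crossTerm_le hb i (hσ l)
            rw [← hB, hB0] at this
            exact abs_nonpos_iff.1 this
          simp only [h0, Finset.sum_const_zero, abs_zero, not_lt]
          positivity
        rw [ae_iff] at hae
        simp only [not_not] at hae
        exact hae.le
      rw [hz]; positivity
    · refine (signLaw_crossTerm_tail hb hLδ.le i k).trans ?_
      rw [← hB]
      have hB2 : 0 < B ^ 2 := by positivity
      have hle : -(k * (L * δ)) ^ 2 / (2 * k * B ^ 2) ≤ -Real.log (2 * m * T) := by
        rw [neg_div, neg_le_neg_iff, le_div_iff₀ (by positivity)]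
        rw [div_mul_eq_mul_div, div_le_iff₀ (by positivity)] at hk2
        nlinarith
      calc 2 * Real.exp (-(k * (L * δ)) ^ 2 / (2 * k * B ^ 2))
          ≤ 2 * Real.exp (-Real.log (2 * m * T)) := by gcongr
        _ = 1 / (m * T) := by
            rw [Real.exp_neg, Real.exp_log (by positivity)]
            field_simp
  have hsub : {σ : ℕ → Fin m → ℝ | ¬ ∀ i,
      |∑ l ∈ Finset.range k, crossTerm (apply A v) i (σ l)| ≤ k * (L * δ)}
      ⊆ ⋃ i ∈ (Finset.univ : Finset (Fin m)),
        {σ | k * (L * δ) < |∑ l ∈ Finset.range k, crossTerm (apply A v) i (σ l)|} := by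
    intro σ hσ
    simpa using hσ
  refine (measureReal_mono hsub (measure_ne_top _ _)).trans
    ((measureReal_biUnion_finset_le _ _).trans ?_)
  refine (Finset.sum_le_sum fun i _ => htail i).trans (le_of_eq ?_)
  rw [Finset.sum_const, Finset.card_univ, Fintype.card_fin, nsmul_eq_mul]
  field_simp

lemma measurable_maxRowNorm (m d : ℕ) : Measurable (maxRowNorm : Mat m d → ℝ) := by
  unfold maxRowNorm
  refine Measurable.iSup fun i => ?_
  have : Measurable fun A : Mat m d => (WithLp.toLp 2 (A i) : Vec d) :=
    (WithLp.measurable_toLp 2 _).comp (measurable_pi_apply i)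
  exact this.norm

lemma measurable_repetitions (m d : ℕ) (Lf L δ : ℝ) (T : ℕ) :
    Measurable (repetitions Lf L δ T : Mat m d → ℕ) := by
  have h := measurable_maxRowNorm m d
  change Measurable fun A : Mat m d => max 1 ⌈(m : ℝ) * ((m : ℝ) - 1) ^ 2 * Lf ^ 2
    * maxRowNorm A ^ 2 / (2 * (1 / 2 * L * δ * √(m : ℝ)) ^ 2) * Real.log (2 * m * T)⌉₊
  exact measurable_const.max (Nat.measurable_ceil.comp (by fun_prop))

/-- A family of measurable functions evaluated at a measurable natural-number index. -/
lemma measurable_apply_nat {α β : Type*} [MeasurableSpace α] [MeasurableSpace β]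
    {F : ℕ → α → β} (hF : ∀ n, Measurable (F n)) {k : α → ℕ} (hk : Measurable k) :
    Measurable fun a => F (k a) a :=
  (measurable_from_prod_countable_right (f := fun p : ℕ × α => F p.1 p.2) hF).comp
    (hk.prodMk measurable_id)

/-- Joint measurability in the vector and the seed is needed because the gradient is itself random,
determined by the past. -/
lemma measurableSet_isGoodSeed (m d s : ℕ) (Lf L δ : ℝ) (T : ℕ) :
    MeasurableSet {p : Vec d × Seed m d | IsGoodSeed s Lf L δ T p.1 p.2} := by
  have hk : Measurable fun p : Vec d × Seed m d => repetitions Lf L δ T p.2.1 :=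
    (measurable_repetitions m d Lf L δ T).comp (measurable_fst.comp measurable_snd)
  have e : {p : Vec d × Seed m d | IsGoodSeed s Lf L δ T p.1 p.2}
      = ((fun p : Vec d × Seed m d => p.2.1) ⁻¹' {A | IsGoodMatrix s A}
        ∩ (⋂ l, ⋂ i, {p | |p.2.2 l i| = 1}))
        ∩ ⋂ i, {p | |∑ l ∈ Finset.range (repetitions Lf L δ T p.2.1),
            crossTerm (apply p.2.1 p.1) i (p.2.2 l)| ≤ repetitions Lf L δ T p.2.1 * (L * δ)} := by
    ext p
    simp only [Set.mem_ofPred_eq, Set.mem_inter_iff, Set.mem_iInter, Set.mem_preimage]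
    exact ⟨fun h => ⟨⟨h.1, h.2⟩, h.3⟩, fun h => ⟨h.1.1, h.1.2, h.2⟩⟩
  rw [e]
  refine (MeasurableSet.inter ?_ ?_).inter ?_
  · exact (measurable_fst.comp measurable_snd) (measurableSet_isGoodMatrix m d s)
  · refine MeasurableSet.iInter fun l => MeasurableSet.iInter fun i => ?_
    exact measurableSet_eq_fun (by fun_prop) measurable_const
  · refine MeasurableSet.iInter fun i => measurableSet_le ?_ ?_
    · refine measurable_apply_nat (F := fun n (p : Vec d × Seed m d) =>
        |∑ l ∈ Finset.range n, crossTerm (apply p.2.1 p.1) i (p.2.2 l)|) (fun n => ?_) hk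
      unfold crossTerm apply
      fun_prop
    · exact (measurable_from_nat (f := fun n : ℕ => (n : ℝ) * (L * δ))).comp hk

lemma prod_real_le {α β : Type*} [MeasurableSpace α] [MeasurableSpace β] (μ : Measure α)
    (ν : Measure β) [IsProbabilityMeasure μ] [IsProbabilityMeasure ν] {S : Set (α × β)}
    (hS : MeasurableSet S) {c : ℝ} (hc : 0 ≤ c) (h : ∀ᵐ a ∂μ, ν.real (Prod.mk a ⁻¹' S) ≤ c) :
    (μ.prod ν).real S ≤ c := by
  refine ENNReal.toReal_le_of_le_ofReal hc ?_
  rw [Measure.prod_apply hS]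
  calc ∫⁻ a, ν (Prod.mk a ⁻¹' S) ∂μ ≤ ∫⁻ _, ENNReal.ofReal c ∂μ := by
        refine lintegral_mono_ae ?_
        filter_upwards [h] with a ha
        exact (ENNReal.le_ofReal_iff_toReal_le (measure_ne_top _ _) hc).2 ha
    _ = ENNReal.ofReal c := by simp

lemma seedLaw_not_good_le {m d s T : ℕ} {Lf L δ : ℝ} (hs : 1 ≤ s) (hsd : s ≤ d) (hT : 1 ≤ T)
    (hLδ : 0 < L * δ)
    (hm : 800 * (2 * s * Real.log (Real.exp 1 * d / (2 * s)) + Real.log (4 * T)) ≤ m)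
    {v : Vec d} (hv : ‖v‖ ≤ Lf) :
    (seedLaw m d).real {ξ | ¬ IsGoodSeed s Lf L δ T v ξ} ≤ 2 / T := by
  have hT' : (0 : ℝ) < T := by exact_mod_cast hT
  have hgood : MeasurableSet {ξ : Seed m d | IsGoodSeed s Lf L δ T v ξ} :=
    (measurable_prodMk_left (x := v)) (measurableSet_isGoodSeed m d s Lf L δ T)
  set M := {ξ : Seed m d | ¬ IsGoodMatrix s ξ.1} with hM
  have hMm : MeasurableSet M := (measurable_fst (measurableSet_isGoodMatrix m d s)).compl
  set S := {ξ : Seed m d | ¬ IsGoodSeed s Lf L δ T v ξ} \ M with hSdef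
  have hSm : MeasurableSet S := hgood.compl.diff hMm
  have h1 : (seedLaw m d).real M ≤ 1 / T := by
    have : (seedLaw m d).real M = (gaussianMatrix m d).real {A | ¬ IsGoodMatrix s A} := by
      exact (measurePreserving_fst (μ := gaussianMatrix m d) (ν := signLaw m)).measureReal_preimage
        (measurableSet_isGoodMatrix m d s).compl.nullMeasurableSet
    rw [this]
    exact gaussianMatrix_not_good_le_inv hs hsd hT hm
  have h2 : (seedLaw m d).real S ≤ 1 / T := by
    rw [seedLaw_eq]
    -- Freezing `A` makes the number of repetitions deterministic, as Hoeffding's inequality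
    -- requires.
    refine prod_real_le _ _ hSm (by positivity) (Filter.Eventually.of_forall fun A => ?_)
    refine (ENNReal.toReal_mono (measure_ne_top _ _) (measure_mono_ae ?_)).trans
      (signLaw_not_cross_le hT hLδ A hv)
    filter_upwards [ae_signLaw_abs m] with σ hσ hmem
    intro hcon
    exact hmem.1 ⟨not_not.1 hmem.2, hσ, hcon⟩
  have hsub : {ξ : Seed m d | ¬ IsGoodSeed s Lf L δ T v ξ} ⊆ M ∪ S := by
    intro ξ hξ
    by_cases h : ξ ∈ M
    · exact Or.inl h
    · exact Or.inr ⟨hξ, h⟩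
  calc _ ≤ _ := measureReal_mono hsub
    _ ≤ _ := measureReal_union_le _ _
    _ ≤ 1 / T + 1 / T := add_le_add h1 h2
    _ = 2 / T := by ring

/-! ### The expected number of samples -/

/-- The antiderivative comes from integrating by parts twice; it evaluates the majorant of the
Gaussian tail in `integral_excess_le`. -/
lemma hasDerivAt_sq_sub_mul_exp {a : ℝ} (ha : 0 < a) (y : ℝ) :
    HasDerivAt (fun y => -((y ^ 2 - a ^ 2) / a + 2 * y / a ^ 2 + 2 / a ^ 3) * Real.exp (-(a * y)))
      ((y ^ 2 - a ^ 2) * Real.exp (-(a * y))) y := by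
  have h1 : HasDerivAt (fun y : ℝ => -((y ^ 2 - a ^ 2) / a + 2 * y / a ^ 2 + 2 / a ^ 3))
      (-(2 * y / a + 2 / a ^ 2)) y := by
    have hsq : HasDerivAt (fun y : ℝ => (y ^ 2 - a ^ 2) / a) (2 * y / a) y := by
      simpa using ((hasDerivAt_pow 2 y).sub_const (a ^ 2)).div_const a
    have hlin : HasDerivAt (fun y : ℝ => 2 * y / a ^ 2) (2 / a ^ 2) y := by
      simpa using ((hasDerivAt_id y).const_mul 2).div_const (a ^ 2)
    exact ((hsq.add hlin).add_const _).neg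
  have h2 : HasDerivAt (fun y : ℝ => Real.exp (-(a * y))) (Real.exp (-(a * y)) * -a) y := by
    have : HasDerivAt (fun y : ℝ => -(a * y)) (-a) y :=
      (((hasDerivAt_id y).const_mul a).neg).congr_deriv (by simp)
    exact this.exp
  refine (h1.mul h2).congr_deriv ?_
  field_simp
  ring

lemma tendsto_pow_mul_exp_neg {a : ℝ} (ha : 0 < a) (n : ℕ) :
    Filter.Tendsto (fun y : ℝ => y ^ n * Real.exp (-(a * y))) Filter.atTop (nhds 0) := by
  have := tendsto_rpow_mul_exp_neg_mul_atTop_nhds_zero (n : ℝ) a ha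
  refine this.congr fun y => ?_
  rw [Real.rpow_natCast, neg_mul]

lemma tendsto_sq_sub_mul_exp {a : ℝ} (ha : 0 < a) :
    Filter.Tendsto
      (fun y => -((y ^ 2 - a ^ 2) / a + 2 * y / a ^ 2 + 2 / a ^ 3) * Real.exp (-(a * y)))
      Filter.atTop (nhds 0) := by
  have h := (((tendsto_pow_mul_exp_neg ha 2).const_mul (-(1 / a))).add
    ((tendsto_pow_mul_exp_neg ha 1).const_mul (-(2 / a ^ 2)))).add
    ((tendsto_pow_mul_exp_neg ha 0).const_mul (a - 2 / a ^ 3))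
  simp only [mul_zero, add_zero] at h
  refine h.congr fun y => ?_
  field_simp
  ring

lemma integrable_sq_gaussianReal : Integrable (fun x : ℝ => x ^ 2) (gaussianReal 0 1) :=
  (memLp_id_gaussianReal 2).integrable_sq

lemma integrable_excess (a : ℝ) :
    Integrable (fun x : ℝ => max (x ^ 2 - a ^ 2) 0) (gaussianReal 0 1) := by
  refine integrable_sq_gaussianReal.mono (Continuous.aestronglyMeasurable (by fun_prop))
    (Filter.Eventually.of_forall fun x => ?_)
  rw [Real.norm_of_nonneg (le_max_right _ _), Real.norm_of_nonneg (sq_nonneg x)]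
  exact max_le (by linarith [sq_nonneg a]) (sq_nonneg x)

/-- The expected excess of the square of a standard Gaussian over the level `a²`. -/
lemma integral_excess_le {a : ℝ} (ha : 0 < a) :
    ∫ x, max (x ^ 2 - a ^ 2) 0 ∂(gaussianReal 0 1)
      ≤ 2 * (√(2 * Real.pi))⁻¹ * (2 / a + 2 / a ^ 3) * Real.exp (-(a ^ 2 / 2)) := by
  set c := (√(2 * Real.pi))⁻¹ with hc
  have hc0 : 0 ≤ c := by positivity
  set g : ℝ → ℝ := fun y => c * Real.exp (-(y ^ 2 / 2)) * max (y ^ 2 - a ^ 2) 0 with hg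
  have e : ∫ x, max (x ^ 2 - a ^ 2) 0 ∂(gaussianReal 0 1) = ∫ x, g |x| := by
    rw [integral_gaussianReal_eq_integral_smul one_ne_zero]
    refine integral_congr_ae (Filter.Eventually.of_forall fun x => ?_)
    simp [hg, gaussianPDFReal, hc, neg_div]
  have e2 : ∫ y in Set.Ioi 0, g y = ∫ y in Set.Ioi a, g y := by
    refine (setIntegral_eq_of_subset_of_forall_sdiff_eq_zero measurableSet_Ioi
      (Set.Ioi_subset_Ioi ha.le) fun y hy => ?_)
    have h1 : y ≤ a := not_lt.1 hy.2
    have h0 : 0 < y := hy.1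
    have : y ^ 2 - a ^ 2 ≤ 0 := by nlinarith
    simp [hg, max_eq_right this]
  set G : ℝ → ℝ := fun y => c * Real.exp (a ^ 2 / 2) * ((y ^ 2 - a ^ 2) * Real.exp (-(a * y)))
    with hG
  have hnn : ∀ y ∈ Set.Ioi a, 0 ≤ (y ^ 2 - a ^ 2) * Real.exp (-(a * y)) := by
    intro y hy
    have : a < y := hy
    have : 0 ≤ y ^ 2 - a ^ 2 := by nlinarith
    positivity
  have hint : IntegrableOn (fun y => (y ^ 2 - a ^ 2) * Real.exp (-(a * y))) (Set.Ioi a) :=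
    integrableOn_Ioi_deriv_of_nonneg' (fun y _ => hasDerivAt_sq_sub_mul_exp ha y) hnn
      (tendsto_sq_sub_mul_exp ha)
  have hval : ∫ y in Set.Ioi a, (y ^ 2 - a ^ 2) * Real.exp (-(a * y))
      = (2 / a + 2 / a ^ 3) * Real.exp (-a ^ 2) := by
    rw [integral_Ioi_of_hasDerivAt_of_nonneg' (fun y _ => hasDerivAt_sq_sub_mul_exp ha y) hnn
      (tendsto_sq_sub_mul_exp ha)]
    have : -(a * a) = -a ^ 2 := by ring
    rw [this]
    field_simp
    ring
  have hgG : ∀ y ∈ Set.Ioi a, g y ≤ G y := by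
    intro y hy
    have hay : a < y := hy
    have h0 : 0 ≤ y ^ 2 - a ^ 2 := by nlinarith
    simp only [hg, hG, max_eq_left h0]
    -- From `(y - a)² ≥ 0`: the Gaussian exponent lies below its tangent at `a`, which makes the
    -- tail integral elementary.
    have : Real.exp (-(y ^ 2 / 2)) ≤ Real.exp (a ^ 2 / 2) * Real.exp (-(a * y)) := by
      rw [← Real.exp_add, Real.exp_le_exp]
      nlinarith [sq_nonneg (y - a)]
    calc c * Real.exp (-(y ^ 2 / 2)) * (y ^ 2 - a ^ 2)
        ≤ c * (Real.exp (a ^ 2 / 2) * Real.exp (-(a * y))) * (y ^ 2 - a ^ 2) := by gcongr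
      _ = _ := by ring
  have hGint : IntegrableOn G (Set.Ioi a) := hint.const_mul _
  have hgint : IntegrableOn g (Set.Ioi a) := by
    refine hGint.mono' (Continuous.aestronglyMeasurable (by fun_prop)) ?_
    filter_upwards [ae_restrict_mem measurableSet_Ioi] with y hy
    have : 0 ≤ g y := by
      simp only [hg]
      have := le_max_right (y ^ 2 - a ^ 2) 0
      positivity
    rw [Real.norm_of_nonneg this]
    exact hgG y hy
  rw [e, integral_comp_abs, e2]
  calc 2 * ∫ y in Set.Ioi a, g y ≤ 2 * ∫ y in Set.Ioi a, G y := by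
        gcongr 2 * ?_
        exact setIntegral_mono_on hgint hGint measurableSet_Ioi hgG
    _ = 2 * c * (2 / a + 2 / a ^ 3) * Real.exp (-(a ^ 2 / 2)) := by
        rw [hG, integral_const_mul, hval]
        have : Real.exp (-(a ^ 2 / 2)) = Real.exp (a ^ 2 / 2) * Real.exp (-a ^ 2) := by
          rw [← Real.exp_add]; ring_nf
        rw [this]; ring

/-- Each squared entry is at most `a²` plus its excess. The excesses of all rows bound those of the
maximal row, so no tail bound for the maximum is needed. -/
lemma maxRowNorm_sq_le {m d : ℕ} (hm : 0 < m) (a : ℝ) (A : Mat m d) :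
    maxRowNorm A ^ 2 ≤ d * a ^ 2 + ∑ i, ∑ j, max (A i j ^ 2 - a ^ 2) 0 := by
  have : Nonempty (Fin m) := ⟨⟨0, hm⟩⟩
  obtain ⟨i, hi⟩ := exists_eq_ciSup_of_finite (f := fun i => ‖(WithLp.toLp 2 (A i) : Vec d)‖)
  rw [maxRowNorm, ← hi, EuclideanSpace.real_norm_sq_eq]
  calc ∑ j, A i j ^ 2 ≤ ∑ j, (a ^ 2 + max (A i j ^ 2 - a ^ 2) 0) :=
        Finset.sum_le_sum fun j _ => by linarith [le_max_left (A i j ^ 2 - a ^ 2) 0]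
    _ = d * a ^ 2 + ∑ j, max (A i j ^ 2 - a ^ 2) 0 := by
        rw [Finset.sum_add_distrib]; simp
    _ ≤ _ := by
        gcongr
        exact Finset.single_le_sum (f := fun i => ∑ j, max (A i j ^ 2 - a ^ 2) 0)
          (fun i _ => Finset.sum_nonneg fun j _ => le_max_right _ _) (Finset.mem_univ i)

lemma measurePreserving_entry (m d : ℕ) (i : Fin m) (j : Fin d) :
    MeasurePreserving (fun A : Mat m d => A i j) (gaussianMatrix m d) (gaussianReal 0 1) :=
  (measurePreserving_eval (fun _ : Fin d => gaussianReal 0 1) j).comp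
    (measurePreserving_eval (fun _ : Fin m => Measure.pi fun _ : Fin d => gaussianReal 0 1) i)

lemma integrable_maxRowNorm_sq {m d : ℕ} (hm : 0 < m) :
    Integrable (fun A : Mat m d => maxRowNorm A ^ 2) (gaussianMatrix m d) := by
  have hI : Integrable (fun A : Mat m d => (d : ℝ) * 0 ^ 2 + ∑ i, ∑ j, max (A i j ^ 2 - 0 ^ 2) 0)
      (gaussianMatrix m d) :=
    (integrable_const _).add (integrable_finsetSum _ fun i _ => integrable_finsetSum _ fun j _ =>
      (measurePreserving_entry m d i j).integrable_comp_of_integrable (integrable_excess 0))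
  refine hI.mono' ((measurable_maxRowNorm m d).pow_const 2).aestronglyMeasurable
    (Filter.Eventually.of_forall fun A => ?_)
  rw [Real.norm_of_nonneg (sq_nonneg _)]
  exact maxRowNorm_sq_le hm 0 A

/-- The level `a² = 2 log m` makes the expected excess of one entry at most `2 log 2 / m`. Over `md`
entries this adds `2d log 2`, turning `log m` into `log(2m)`. -/
lemma integral_maxRowNorm_sq_le {m d : ℕ} (hm : 8 ≤ m) :
    ∫ A, maxRowNorm A ^ 2 ∂(gaussianMatrix m d) ≤ 2 * d * Real.log (2 * m) := by
  have hm' : (8 : ℝ) ≤ m := by exact_mod_cast hm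
  have hm0 : 0 < m := by omega
  have hlog : 2 ≤ Real.log m := by
    have h1 : Real.log 8 ≤ Real.log m := Real.log_le_log (by norm_num) hm'
    have h2 : Real.log 8 = 3 * Real.log 2 := by
      rw [show (8 : ℝ) = 2 ^ 3 by norm_num, Real.log_pow]; norm_num
    have := Real.log_two_gt_d9
    linarith
  set a := √(2 * Real.log m) with ha
  have ha2 : a ^ 2 = 2 * Real.log m := Real.sq_sqrt (by linarith)
  have haw : 2 ≤ a := by
    rw [ha]; exact Real.le_sqrt_of_sq_le (by linarith)
  have hexc : ∫ x, max (x ^ 2 - a ^ 2) 0 ∂(gaussianReal 0 1) ≤ 2 * Real.log 2 / m := by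
    refine (integral_excess_le (by linarith)).trans ?_
    have e : Real.exp (-(a ^ 2 / 2)) = 1 / m := by
      rw [ha2, mul_div_cancel_left₀ _ (by norm_num), Real.exp_neg, Real.exp_log (by linarith),
        one_div]
    rw [e, ← mul_div_assoc, mul_one]
    have hpi : (√(2 * Real.pi))⁻¹ ≤ 1 / 2 := by
      rw [inv_le_comm₀ (by positivity) (by norm_num)]
      refine Real.le_sqrt_of_sq_le ?_
      have := Real.pi_gt_three
      norm_num; linarith
    have h1 : 2 / a ≤ 1 := by rw [div_le_one (by linarith)]; exact haw
    have h2 : 2 / a ^ 3 ≤ 1 / 4 := by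
      rw [div_le_div_iff₀ (by positivity) (by norm_num)]
      have : (2 : ℝ) ^ 3 ≤ a ^ 3 := by gcongr
      linarith
    have h3 : 0 ≤ 2 / a + 2 / a ^ 3 := by positivity
    have := Real.log_two_gt_d9
    refine div_le_div_of_nonneg_right ?_ (by linarith)
    -- The hypothesis `8 ≤ m` gives `a ≥ 2`, and the resulting `5/4` is below `2 log 2`.
    calc 2 * (√(2 * Real.pi))⁻¹ * (2 / a + 2 / a ^ 3) ≤ 2 * (1 / 2) * (1 + 1 / 4) := by gcongr
      _ ≤ _ := by linarith
  have hent : ∀ i j, ∫ A : Mat m d, max (A i j ^ 2 - a ^ 2) 0 ∂(gaussianMatrix m d)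
      = ∫ x, max (x ^ 2 - a ^ 2) 0 ∂(gaussianReal 0 1) := by
    intro i j
    rw [← (measurePreserving_entry m d i j).map_eq, integral_map
      (measurePreserving_entry m d i j).measurable.aemeasurable
      (Continuous.aestronglyMeasurable (by fun_prop))]
  have hI : ∀ i j, Integrable (fun A : Mat m d => max (A i j ^ 2 - a ^ 2) 0)
      (gaussianMatrix m d) := fun i j =>
    (measurePreserving_entry m d i j).integrable_comp_of_integrable (integrable_excess a)
  calc ∫ A, maxRowNorm A ^ 2 ∂(gaussianMatrix m d)
      ≤ ∫ A : Mat m d, (d * a ^ 2 + ∑ i, ∑ j, max (A i j ^ 2 - a ^ 2) 0) ∂(gaussianMatrix m d) :=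
        integral_mono (integrable_maxRowNorm_sq hm0)
          ((integrable_const _).add (integrable_finsetSum _ fun i _ =>
            integrable_finsetSum _ fun j _ => hI i j)) fun A => maxRowNorm_sq_le hm0 a A
    _ = d * a ^ 2 + m * (d * ∫ x, max (x ^ 2 - a ^ 2) 0 ∂(gaussianReal 0 1)) := by
        rw [integral_add (integrable_const _) (integrable_finsetSum _ fun i _ =>
          integrable_finsetSum _ fun j _ => hI i j), integral_finsetSum _ fun i _ =>
          integrable_finsetSum _ fun j _ => hI i j]
        simp_rw [integral_finsetSum _ fun j _ => hI _ j, hent]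
        simp
    _ ≤ d * (2 * Real.log m) + m * (d * (2 * Real.log 2 / m)) := by
        rw [ha2]; rw [ha2] at hexc; gcongr
    _ = 2 * d * Real.log (2 * m) := by
        rw [Real.log_mul (by norm_num) (by linarith)]
        field_simp
        ring

lemma repetitions_le {m d T : ℕ} {Lf L δ : ℝ} (hm : 0 < m) (hT : 1 ≤ T)
    (hLδ : L * δ = 1 / (3 * T)) (A : Mat m d) :
    (repetitions Lf L δ T A : ℝ)
      ≤ 18 * ((m : ℝ) - 1) ^ 2 * Lf ^ 2 * T ^ 2 * Real.log (2 * m * T) * maxRowNorm A ^ 2 + 1 := by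
  have hT' : (1 : ℝ) ≤ T := by exact_mod_cast hT
  have hm' : (1 : ℝ) ≤ m := by exact_mod_cast hm
  have hlog : 0 ≤ Real.log (2 * m * T) := Real.log_nonneg (by nlinarith)
  have hX : 2 * (((m : ℝ) - 1) * (Lf * maxRowNorm A)) ^ 2 / (L * δ) ^ 2 * Real.log (2 * m * T)
      = 18 * ((m : ℝ) - 1) ^ 2 * Lf ^ 2 * T ^ 2 * Real.log (2 * m * T) * maxRowNorm A ^ 2 := by
    rw [hLδ]; field_simp; ring
  rw [repetitions_eq hm, hX]
  set X := 18 * ((m : ℝ) - 1) ^ 2 * Lf ^ 2 * T ^ 2 * Real.log (2 * m * T) * maxRowNorm A ^ 2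
  have hX0 : 0 ≤ X := by positivity
  push_cast
  exact max_le (by linarith) (Nat.ceil_lt_add_one hX0).le

lemma measurePreserving_matrix (m d t : ℕ) :
    MeasurePreserving (fun ω : Outcome m d => (ω t).1) (outcomeLaw m d) (gaussianMatrix m d) :=
  (measurePreserving_fst (μ := gaussianMatrix m d) (ν := signLaw m)).comp
    (measurePreserving_eval_infinitePi (fun _ : ℕ => seedLaw m d) t)

lemma numSamples_eq {m d T : ℕ} {K : Set (Vec d)} {Lf L η δ : ℝ} {rec : Mat m d → Vec m → Vec d}
    {x₁ : Vec d} {f : ℕ → Outcome m d → Vec d → ℝ} {t : ℕ} (ω : Outcome m d) :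
    numSamples K Lf L η δ T rec x₁ f t ω = repetitions Lf L δ T (ω t).1 + 1 := by
  simp [numSamples, queries]

lemma integral_numSamples_le {m d T : ℕ} {K : Set (Vec d)} {Lf L η δ : ℝ}
    {rec : Mat m d → Vec m → Vec d} {x₁ : Vec d} {f : ℕ → Outcome m d → Vec d → ℝ} {t : ℕ}
    (hm : 8 ≤ m) (hT : 1 ≤ T) (hLδ : L * δ = 1 / (3 * T)) :
    Integrable (fun ω => (numSamples K Lf L η δ T rec x₁ f t ω : ℝ)) (outcomeLaw m d) ∧
      ∫ ω, (numSamples K Lf L η δ T rec x₁ f t ω : ℝ) ∂(outcomeLaw m d)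
        ≤ 36 * d * ((m : ℝ) - 1) ^ 2 * Lf ^ 2 * Real.log (2 * m) * (T : ℝ) ^ 2
            * Real.log (2 * m * T) + 2 := by
  have hT' : (1 : ℝ) ≤ T := by exact_mod_cast hT
  have hm0 : 0 < m := by omega
  have hm' : (8 : ℝ) ≤ m := by exact_mod_cast hm
  have hlog : 0 ≤ Real.log (2 * m * T) := Real.log_nonneg (by nlinarith)
  simp_rw [numSamples_eq]
  push_cast
  set c := 18 * ((m : ℝ) - 1) ^ 2 * Lf ^ 2 * T ^ 2 * Real.log (2 * m * T) with hc
  have hc0 : 0 ≤ c := by positivity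
  have hIA : Integrable (fun A : Mat m d => (repetitions Lf L δ T A : ℝ)) (gaussianMatrix m d) := by
    refine (((integrable_maxRowNorm_sq hm0).const_mul c).add (integrable_const 1)).mono'
      ((measurable_from_nat (f := fun n : ℕ => (n : ℝ))).comp
        (measurable_repetitions m d Lf L δ T)).aestronglyMeasurable
      (Filter.Eventually.of_forall fun A => ?_)
    rw [Real.norm_of_nonneg (by positivity)]
    exact repetitions_le hm0 hT hLδ A
  have hIω : Integrable (fun ω : Outcome m d => (repetitions Lf L δ T (ω t).1 : ℝ))
      (outcomeLaw m d) :=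
    (measurePreserving_matrix m d t).integrable_comp_of_integrable hIA
  refine ⟨hIω.add (integrable_const 1), ?_⟩
  rw [integral_add hIω (integrable_const 1)]
  have e : ∫ ω : Outcome m d, (repetitions Lf L δ T (ω t).1 : ℝ) ∂(outcomeLaw m d)
      = ∫ A, (repetitions Lf L δ T A : ℝ) ∂(gaussianMatrix m d) := by
    rw [← (measurePreserving_matrix m d t).map_eq, integral_map
      (measurePreserving_matrix m d t).measurable.aemeasurable]
    rw [(measurePreserving_matrix m d t).map_eq]
    exact hIA.aestronglyMeasurable
  have h1 : ∫ A : Mat m d, (repetitions Lf L δ T A : ℝ) ∂(gaussianMatrix m d)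
      ≤ c * (2 * d * Real.log (2 * m)) + 1 := by
    calc _ ≤ ∫ A : Mat m d, (c * maxRowNorm A ^ 2 + 1) ∂(gaussianMatrix m d) :=
          integral_mono hIA (((integrable_maxRowNorm_sq hm0).const_mul c).add (integrable_const 1))
            fun A => repetitions_le hm0 hT hLδ A
      _ = c * ∫ A : Mat m d, maxRowNorm A ^ 2 ∂(gaussianMatrix m d) + 1 := by
          rw [integral_add ((integrable_maxRowNorm_sq hm0).const_mul c) (integrable_const 1),
            integral_const_mul]
          simp
      _ ≤ _ := by
          have := integral_maxRowNorm_sq_le (d := d) hm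
          gcongr
  rw [e]
  simp only [integral_const, probReal_univ, smul_eq_mul, mul_one]
  have : c * (2 * d * Real.log (2 * m)) = 36 * d * ((m : ℝ) - 1) ^ 2 * Lf ^ 2 * Real.log (2 * m)
      * (T : ℝ) ^ 2 * Real.log (2 * m * T) := by rw [hc]; ring
  linarith

/-! ### Projection onto the constraint set -/

section Projection

variable {d : ℕ} {K : Set (Vec d)}

lemma project_spec (hK : IsCompact K) (hne : K.Nonempty) (v : Vec d) :
    project K v ∈ K ∧ ∀ z ∈ K, ‖project K v - v‖ ≤ ‖z - v‖ := by
  obtain ⟨p, hp, hmin⟩ := hK.exists_isMinOn hne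
    (f := fun z => ‖z - v‖) (Continuous.continuousOn (by fun_prop))
  exact Classical.epsilon_spec (p := fun p => p ∈ K ∧ ∀ z ∈ K, ‖p - v‖ ≤ ‖z - v‖)
    ⟨p, hp, fun z hz => hmin hz⟩

lemma inner_project_le (hK : IsCompact K) (hc : Convex ℝ K) (hne : K.Nonempty) (v : Vec d)
    {u : Vec d} (hu : u ∈ K) : inner ℝ (v - project K v) (u - project K v) ≤ 0 := by
  obtain ⟨hp, hmin⟩ := project_spec hK hne v
  have : Nonempty K := hne.to_subtype
  refine (norm_eq_iInf_iff_real_inner_le_zero hc hp).1 (le_antisymm ?_ ?_) u hu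
  · refine le_ciInf fun z => ?_
    rw [norm_sub_rev, norm_sub_rev v]
    exact hmin z z.2
  · exact ciInf_le (f := fun w : K => ‖v - w‖)
      ⟨0, by rintro _ ⟨z, rfl⟩; exact norm_nonneg _⟩ ⟨_, hp⟩

/-- Adding the variational inequalities of the two projections gives `‖p - q‖² ≤ ⟨v - w, p - q⟩`. It
supplies continuity, hence measurability of the iterates. -/
lemma norm_project_sub_le (hK : IsCompact K) (hc : Convex ℝ K) (hne : K.Nonempty) (v w : Vec d) :
    ‖project K v - project K w‖ ≤ ‖v - w‖ := by
  have h1 := inner_project_le hK hc hne v (project_spec hK hne w).1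
  have h2 := inner_project_le hK hc hne w (project_spec hK hne v).1
  set p := project K v
  set q := project K w
  have h3 : ‖p - q‖ ^ 2 ≤ inner ℝ (v - w) (p - q) := by
    rw [← real_inner_self_eq_norm_sq]
    have e : inner ℝ (v - w) (p - q) - inner ℝ (p - q) (p - q)
        = -(inner ℝ (v - p) (q - p) + inner ℝ (w - q) (p - q)) := by
      simp only [inner_sub_left, inner_sub_right]
      ring
    linarith
  have h4 := real_inner_le_norm (v - w) (p - q)
  rcases (norm_nonneg (p - q)).eq_or_lt with h0 | h0
  · rw [← h0]; exact norm_nonneg _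
  · nlinarith

lemma norm_project_sub_sq_le (hK : IsCompact K) (hc : Convex ℝ K) (hne : K.Nonempty) (v : Vec d)
    {u : Vec d} (hu : u ∈ K) : ‖project K v - u‖ ^ 2 ≤ ‖v - u‖ ^ 2 := by
  have h := inner_project_le hK hc hne v hu
  set p := project K v
  have e : v - u = (v - p) - (u - p) := by abel
  rw [e, norm_sub_sq_real (v - p), norm_sub_rev p u]
  nlinarith [sq_nonneg ‖v - p‖]

lemma continuous_project (hK : IsCompact K) (hc : Convex ℝ K) (hne : K.Nonempty) :
    Continuous (project K) := by
  refine (LipschitzWith.of_dist_le_mul (K := 1) fun v w => ?_).continuous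
  rw [dist_eq_norm, dist_eq_norm, NNReal.coe_one, one_mul]
  exact norm_project_sub_le hK hc hne v w

/-- One projected gradient step. -/
lemma inner_le_of_step (hK : IsCompact K) (hc : Convex ℝ K) (hne : K.Nonempty) {η : ℝ}
    (hη : 0 < η) (x g : Vec d) {u : Vec d} (hu : u ∈ K) :
    inner ℝ g (x - u)
      ≤ (‖x - u‖ ^ 2 - ‖project K (x - η • g) - u‖ ^ 2) / (2 * η) + η / 2 * ‖g‖ ^ 2 := by
  have h := norm_project_sub_sq_le hK hc hne (x - η • g) hu
  have e : ‖x - η • g - u‖ ^ 2 = ‖x - u‖ ^ 2 - 2 * η * inner ℝ g (x - u) + η ^ 2 * ‖g‖ ^ 2 := by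
    rw [show x - η • g - u = (x - u) - η • g by abel, norm_sub_sq_real, inner_smul_right,
      norm_smul, mul_pow, Real.norm_eq_abs, sq_abs, real_inner_comm]
    ring
  rw [e] at h
  rw [← sub_le_iff_le_add, le_div_iff₀ (by positivity)]
  nlinarith

end Projection

/-! ### Independence from the past -/

/-- A measurable quantity determined by the draws before round `t` is independent of the draw of
round `t`. -/
lemma indepFun_eval_of_past {m d t : ℕ} {β : Type*} [MeasurableSpace β] {Y : Outcome m d → β}
    (hY : Measurable Y) (hpast : ∀ ω ω' : Outcome m d, (∀ r < t, ω r = ω' r) → Y ω = Y ω') :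
    IndepFun Y (fun ω : Outcome m d => ω t) (outcomeLaw m d) := by
  have hind : iIndepFun (fun (r : ℕ) (ω : Outcome m d) => ω r) (outcomeLaw m d) :=
    iIndepFun_infinitePi (X := fun (_ : ℕ) (ξ : Seed m d) => ξ) fun _ => measurable_id
  have h := hind.indepFun_finset (Finset.range t) {t} (by simp) fun r => measurable_pi_apply r
  -- Padding the first `t` draws by zeros recovers `Y`, so `Y` factors through coordinates
  -- independent of coordinate `t`.
  let ext : ((r : Finset.range t) → Seed m d) → Outcome m d := fun p r =>
    if hr : r ∈ Finset.range t then p ⟨r, hr⟩ else 0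
  have hext : Measurable ext := by
    refine measurable_pi_lambda _ fun r => ?_
    by_cases hr : r ∈ Finset.range t
    · simp only [ext, hr, dite_true]
      exact measurable_pi_apply _
    · simp only [ext, hr, dite_false]
      exact measurable_const
  have hψ : Measurable fun q : ({t} : Finset ℕ) → Seed m d => q ⟨t, Finset.mem_singleton_self t⟩ :=
    measurable_pi_apply _
  have h2 := h.comp (hY.comp hext) hψ
  have e : (Y ∘ ext) ∘ (fun (ω : Outcome m d) (r : Finset.range t) => ω r) = Y := by
    ext1 ω
    refine hpast _ _ fun r hr => ?_
    simp [ext, hr]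
  rw [e] at h2
  exact h2

/-- Freezing principle: the joint law of the past quantity and the new draw is a product, so a bound
uniform over frozen values passes to the random one. -/
lemma outcomeLaw_real_le {m d t : ℕ} {β : Type*} [MeasurableSpace β] {Y : Outcome m d → β}
    (hY : Measurable Y) (hpast : ∀ ω ω' : Outcome m d, (∀ r < t, ω r = ω' r) → Y ω = Y ω')
    {S : Set (β × Seed m d)} (hS : MeasurableSet S) {c : ℝ} (hc : 0 ≤ c)
    (h : ∀ ω, (seedLaw m d).real (Prod.mk (Y ω) ⁻¹' S) ≤ c) :
    (outcomeLaw m d).real {ω | (Y ω, ω t) ∈ S} ≤ c := by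
  have hind := indepFun_eval_of_past hY hpast
  have hev : Measurable fun ω : Outcome m d => ω t := measurable_pi_apply t
  have hlaw : (outcomeLaw m d).map (fun ω => (Y ω, ω t))
      = ((outcomeLaw m d).map Y).prod (seedLaw m d) := by
    rw [(indepFun_iff_map_prod_eq_prod_map_map hY.aemeasurable hev.aemeasurable).1 hind]
    congr 1
    exact (measurePreserving_eval_infinitePi (fun _ : ℕ => seedLaw m d) t).map_eq
  have : IsProbabilityMeasure ((outcomeLaw m d).map Y) :=
    Measure.isProbabilityMeasure_map hY.aemeasurable
  have key := prod_real_le ((outcomeLaw m d).map Y) (seedLaw m d) hS hc (by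
    rw [ae_map_iff hY.aemeasurable]
    · exact Filter.Eventually.of_forall h
    · exact measurableSet_le (measurable_measure_prodMk_left hS).ennreal_toReal measurable_const)
  rw [← hlaw, map_measureReal_apply (hY.prodMk hev) hS] at key
  exact key

/-! ### Measurability of the run -/

section Run

variable {d s T m : ℕ} {Lf L R η δ : ℝ} {K : Set (Vec d)} {x₁ : Vec d}
  {rec : Mat m d → Vec m → Vec d} {f : ℕ → Outcome m d → Vec d → ℝ}

lemma measurable_toLp_of_apply {α : Type*} [MeasurableSpace α] {n : ℕ} {F : α → Fin n → ℝ}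
    (hF : ∀ i, Measurable fun a => F a i) :
    Measurable fun a => (WithLp.toLp 2 (F a) : Vec n) :=
  (WithLp.measurable_toLp 2 _).comp (measurable_pi_lambda _ hF)

/-- A Carathéodory function, continuous in the point and measurable in the outcome, is jointly
measurable. -/
lemma IsAdversary.measurable_eval (hf : IsAdversary K Lf L s T f) {t : ℕ} (ht : t < T)
    {z : Outcome m d → Vec d} (hz : Measurable z) : Measurable fun ω => f t ω (z ω) :=
  (measurable_uncurry_of_continuous_of_measurable (u := fun x ω => f t ω x)
    (fun ω => (hf.admissible t ht ω).continuous) (hf.measurable t ht)).comp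
    (hz.prodMk measurable_id)

lemma measurable_perturbed {z : Outcome m d → Vec d} (hz : Measurable z) (t l : ℕ) :
    Measurable fun ω : Outcome m d => perturbed δ (ω t).1 (z ω) ((ω t).2 l) := by
  have hr : Measurable fun ω : Outcome m d => rowCombination (ω t).1 ((ω t).2 l) :=
    measurable_toLp_of_apply fun j => by fun_prop
  unfold perturbed stepScale
  fun_prop

lemma measurable_stepScale (t l : ℕ) :
    Measurable fun ω : Outcome m d => stepScale δ (ω t).1 ((ω t).2 l) := by
  have hr : Measurable fun ω : Outcome m d => rowCombination (ω t).1 ((ω t).2 l) :=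
    measurable_toLp_of_apply fun j => by fun_prop
  unfold stepScale
  fun_prop

lemma IsAdversary.measurable_measurement (hf : IsAdversary K Lf L s T f) {t : ℕ} (ht : t < T)
    {z : Outcome m d → Vec d} (hz : Measurable z) (k : ℕ) :
    Measurable fun ω => measurement δ k (f t ω) (ω t) (z ω) := by
  refine measurable_toLp_of_apply fun i => ?_
  refine (Finset.measurable_sum _ fun l _ => ?_).const_mul _
  refine Measurable.div ((hf.measurable_eval ht (measurable_perturbed hz t l)).sub
    (hf.measurable_eval ht hz)) ((measurable_stepScale t l).mul ?_)
  fun_prop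

lemma IsAdversary.measurable_gradEstimate (hf : IsAdversary K Lf L s T f) {τ ρ : ℝ}
    (hrec : IsBasisPursuit τ ρ rec) {t : ℕ} (ht : t < T)
    {z : Outcome m d → Vec d} (hz : Measurable z) :
    Measurable fun ω =>
      gradEstimate rec δ (repetitions Lf L δ T (ω t).1) (f t ω) (ω t) (z ω) := by
  have hk : Measurable fun ω : Outcome m d => repetitions Lf L δ T (ω t).1 :=
    (measurable_repetitions m d Lf L δ T).comp (by fun_prop)
  have hy := measurable_apply_nat
    (F := fun k ω => measurement δ k (f t ω) (ω t) (z ω))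
    (fun k => hf.measurable_measurement ht hz k) hk
  exact hrec.measurable.comp ((by fun_prop : Measurable fun (ω : Outcome m d) (i : Fin m)
    (j : Fin d) => (1 / √(m : ℝ)) * (ω t).1 i j).prodMk (hy.const_smul (1 / √(m : ℝ))))

lemma measurable_iterate (hK : IsCompact K) (hc : Convex ℝ K) (hne : K.Nonempty)
    (hf : IsAdversary K Lf L s T f) {τ ρ : ℝ} (hrec : IsBasisPursuit τ ρ rec) {t : ℕ}
    (ht : t ≤ T) : Measurable fun ω => iterate K Lf L η δ T rec x₁ f ω t := by
  induction t with
  | zero => exact measurable_const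
  | succ t ih =>
    have hx := ih (by omega)
    exact (continuous_project hK hc hne).measurable.comp
      (hx.sub ((hf.measurable_gradEstimate hrec (by omega) hx).const_smul η))

lemma iterate_mem (hK : IsCompact K) (hx₁ : x₁ ∈ K) (ω : Outcome m d) (t : ℕ) :
    iterate K Lf L η δ T rec x₁ f ω t ∈ K := by
  cases t with
  | zero => exact hx₁
  | succ t => exact (project_spec hK ⟨x₁, hx₁⟩ _).1

lemma iterate_congr (hf : IsAdversary K Lf L s T f) {t : ℕ} (ht : t ≤ T) {ω ω' : Outcome m d}
    (h : ∀ r < t, ω r = ω' r) :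
    iterate K Lf L η δ T rec x₁ f ω t = iterate K Lf L η δ T rec x₁ f ω' t := by
  induction t with
  | zero => rfl
  | succ t ih =>
    have hx := ih (by omega) fun r hr => h r (by omega)
    have h1 := h t (by omega)
    have h2 := hf.nonanticipating t (by omega) ω ω' fun r hr => h r (by omega)
    simp only [iterate, hx, h1, h2]

/-- The partial derivatives are pointwise limits of difference quotients along steps `1/n`. -/
lemma IsAdversary.measurable_gradient (hf : IsAdversary K Lf L s T f) {t : ℕ} (ht : t < T)
    {z : Outcome m d → Vec d} (hz : Measurable z) :
    Measurable fun ω => gradient (f t ω) (z ω) := by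
  have h : ∀ j, Measurable fun ω => gradient (f t ω) (z ω) j := by
    intro j
    set e : Vec d := EuclideanSpace.single j 1 with he
    refine measurable_of_tendsto_metrizable (f := fun (n : ℕ) ω =>
      (n : ℝ) • (f t ω (z ω + (n : ℝ)⁻¹ • e) - f t ω (z ω))) (fun n => ?_) ?_
    · exact ((hf.measurable_eval ht (hz.add_const _)).sub (hf.measurable_eval ht hz)).const_smul (n : ℝ)
    · rw [tendsto_pi_nhds]
      intro ω
      have := ((hf.admissible t ht ω).hasFDerivAt (z ω)).lim e (c := fun n : ℕ => (n : ℝ))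
        (l := Filter.atTop) (by simpa using tendsto_natCast_atTop_atTop)
      rw [innerSL_apply_apply, he, EuclideanSpace.inner_single_right] at this
      simpa using this
  exact measurable_toLp_of_apply h

end Run

/-! ### Regret -/

section Regret

variable {d s T m : ℕ} {Lf L R η δ : ℝ} {K : Set (Vec d)} {x₁ : Vec d}
  {rec : Mat m d → Vec m → Vec d} {f : ℕ → Outcome m d → Vec d → ℝ}

lemma norm_sub_le_of_bounded (hR : ∀ x ∈ K, ‖x‖ ≤ R) {x u : Vec d} (hx : x ∈ K) (hu : u ∈ K) :
    ‖x - u‖ ≤ 2 * R :=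
  (norm_sub_le x u).trans (by linarith [hR x hx, hR u hu])

lemma half_sq_le_halfSqDiam (hR : ∀ x ∈ K, ‖x‖ ≤ R) {x u : Vec d} (hx : x ∈ K) (hu : u ∈ K) :
    1 / 2 * ‖x - u‖ ^ 2 ≤ halfSqDiam K := by
  refine le_ciSup (f := fun p : K × K => (1 / 2) * ‖(p.1 : Vec d) - (p.2 : Vec d)‖ ^ 2)
    ⟨1 / 2 * (2 * R) ^ 2, ?_⟩ (⟨x, hx⟩, ⟨u, hu⟩)
  rintro _ ⟨p, rfl⟩
  have := norm_sub_le_of_bounded hR p.1.2 p.2.2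
  dsimp only
  gcongr

lemma IsAdversary.abs_sub_le (hf : IsAdversary K Lf L s T f) (hLf : 0 ≤ Lf)
    (hR : ∀ x ∈ K, ‖x‖ ≤ R) {t : ℕ} (ht : t < T) (ω : Outcome m d) {x u : Vec d} (hx : x ∈ K)
    (hu : u ∈ K) : |f t ω x - f t ω u| ≤ Lf * (2 * R) :=
  ((hf.admissible t ht ω).lipschitz x u).trans
    (mul_le_mul_of_nonneg_left (norm_sub_le_of_bounded hR hx hu) hLf)

lemma IsAdversary.bddBelow_range (hf : IsAdversary K Lf L s T f) (hLf : 0 ≤ Lf)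
    (hR : ∀ x ∈ K, ‖x‖ ≤ R) (hx₁ : x₁ ∈ K) (ω : Outcome m d) :
    BddBelow (Set.range fun u : K => ∑ t ∈ Finset.range T, f t ω u) := by
  refine ⟨∑ t ∈ Finset.range T, (f t ω x₁ - Lf * (2 * R)), ?_⟩
  rintro _ ⟨u, rfl⟩
  refine Finset.sum_le_sum fun t ht => ?_
  have := abs_le.1 (hf.abs_sub_le hLf hR (Finset.mem_range.1 ht) ω hx₁ u.2)
  linarith [this.2]

lemma regret_le_of_forall {ω : Outcome m d} {b : ℝ} (hne : K.Nonempty)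
    (h : ∀ u ∈ K, ∑ t ∈ Finset.range T,
      (f t ω (iterate K Lf L η δ T rec x₁ f ω t) - f t ω u) ≤ b) :
    regret K Lf L η δ T rec x₁ f ω ≤ b := by
  have : Nonempty K := hne.to_subtype
  rw [regret, sub_le_comm]
  refine le_ciInf fun u => ?_
  have := h u u.2
  rw [Finset.sum_sub_distrib] at this
  linarith

lemma regret_le_trivial (hK : IsCompact K) (hf : IsAdversary K Lf L s T f) (hLf : 0 ≤ Lf)
    (hR : ∀ x ∈ K, ‖x‖ ≤ R) (hx₁ : x₁ ∈ K) (ω : Outcome m d) :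
    regret K Lf L η δ T rec x₁ f ω ≤ T * (Lf * (2 * R)) := by
  refine regret_le_of_forall ⟨x₁, hx₁⟩ fun u hu => ?_
  refine (Finset.sum_le_sum (g := fun _ => Lf * (2 * R)) fun t ht => ?_).trans_eq (by simp)
  exact (abs_le.1 (hf.abs_sub_le hLf hR (Finset.mem_range.1 ht) ω (iterate_mem hK hx₁ ω t) hu)).2

lemma neg_le_regret (hK : IsCompact K) (hf : IsAdversary K Lf L s T f) (hLf : 0 ≤ Lf)
    (hR : ∀ x ∈ K, ‖x‖ ≤ R) (hx₁ : x₁ ∈ K) (ω : Outcome m d) :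
    -(T * (Lf * (2 * R))) ≤ regret K Lf L η δ T rec x₁ f ω := by
  have h1 : ⨅ u : K, ∑ t ∈ Finset.range T, f t ω u ≤ ∑ t ∈ Finset.range T, f t ω x₁ :=
    ciInf_le (hf.bddBelow_range hLf hR hx₁ ω) ⟨x₁, hx₁⟩
  have h2 : -(T * (Lf * (2 * R))) ≤ ∑ t ∈ Finset.range T,
      (f t ω (iterate K Lf L η δ T rec x₁ f ω t) - f t ω x₁) := by
    refine le_trans (le_of_eq (by simp))
      (Finset.sum_le_sum (f := fun _ => -(Lf * (2 * R))) fun t ht => ?_)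
    exact (abs_le.1 (hf.abs_sub_le hLf hR (Finset.mem_range.1 ht) ω
      (iterate_mem hK hx₁ ω t) hx₁)).1
  rw [Finset.sum_sub_distrib] at h2
  rw [regret]
  linarith

/-- Continuity of the costs lets the infimum over `K` be taken over a countable dense sequence. -/
lemma measurable_regret (hK : IsCompact K) (hc : Convex ℝ K) (hf : IsAdversary K Lf L s T f)
    (hLf : 0 ≤ Lf) (hR : ∀ x ∈ K, ‖x‖ ≤ R) (hx₁ : x₁ ∈ K) {τ ρ : ℝ}
    (hrec : IsBasisPursuit τ ρ rec) : Measurable (regret K Lf L η δ T rec x₁ f) := by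
  have : Nonempty K := ⟨⟨x₁, hx₁⟩⟩
  have e : ∀ ω, ⨅ u : K, ∑ t ∈ Finset.range T, f t ω u
      = ⨅ n : ℕ, ∑ t ∈ Finset.range T, f t ω (TopologicalSpace.denseSeq K n) := by
    intro ω
    have hb := hf.bddBelow_range hLf hR hx₁ ω
    refine le_antisymm (le_ciInf fun n => ciInf_le hb _) (le_ciInf fun u => ?_)
    have hcont : Continuous fun u : K => ∑ t ∈ Finset.range T, f t ω u :=
      continuous_finsetSum _ fun t ht =>
        (hf.admissible t (Finset.mem_range.1 ht) ω).continuous.comp continuous_subtype_val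
    refine (TopologicalSpace.denseRange_denseSeq K).induction_on
      (p := fun u : K => (⨅ n : ℕ, ∑ t ∈ Finset.range T, f t ω (TopologicalSpace.denseSeq K n))
        ≤ ∑ t ∈ Finset.range T, f t ω u) u (isClosed_le continuous_const hcont) fun n => ?_
    refine ciInf_le (hb.mono ?_) n
    rintro _ ⟨k, rfl⟩
    exact ⟨_, rfl⟩
  unfold regret
  simp_rw [e]
  refine Measurable.sub (Finset.measurable_sum _ fun t ht => ?_) (Measurable.iInf fun n =>
    Finset.measurable_sum _ fun t ht => hf.measurable t (Finset.mem_range.1 ht) _)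
  have ht' := Finset.mem_range.1 ht
  exact hf.measurable_eval ht' (measurable_iterate hK hc ⟨x₁, hx₁⟩ hf hrec ht'.le)

lemma integrable_regret (hK : IsCompact K) (hc : Convex ℝ K) (hf : IsAdversary K Lf L s T f)
    (hLf : 0 ≤ Lf) (hR : ∀ x ∈ K, ‖x‖ ≤ R) (hx₁ : x₁ ∈ K) {τ ρ : ℝ}
    (hrec : IsBasisPursuit τ ρ rec) :
    Integrable (regret K Lf L η δ T rec x₁ f) (outcomeLaw m d) := by
  refine Integrable.of_bound (measurable_regret hK hc hf hLf hR hx₁ hrec).aestronglyMeasurable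
    (T * (Lf * (2 * R))) (Filter.Eventually.of_forall fun ω => ?_)
  rw [Real.norm_eq_abs, abs_le]
  exact ⟨neg_le_regret hK hf hLf hR hx₁ ω, regret_le_trivial hK hf hLf hR hx₁ ω⟩

/-- The regret is controlled by the norms and the errors of the gradient estimates. -/
lemma regret_le_sum_error (hK : IsCompact K) (hc : Convex ℝ K) (hf : IsAdversary K Lf L s T f)
    (hη : 0 < η) (hR : ∀ x ∈ K, ‖x‖ ≤ R) (hx₁ : x₁ ∈ K) {ρ : ℝ} (ω : Outcome m d) {err : ℕ → ℝ}
    (hg : ∀ t < T, ‖gradEstimate rec δ (repetitions Lf L δ T (ω t).1) (f t ω) (ω t)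
      (iterate K Lf L η δ T rec x₁ f ω t)‖ ≤ ρ)
    (herr : ∀ t < T, ‖gradEstimate rec δ (repetitions Lf L δ T (ω t).1) (f t ω) (ω t)
      (iterate K Lf L η δ T rec x₁ f ω t)
        - gradient (f t ω) (iterate K Lf L η δ T rec x₁ f ω t)‖ ≤ err t) :
    regret K Lf L η δ T rec x₁ f ω
      ≤ halfSqDiam K / η + T * (η / 2 * ρ ^ 2) + 2 * R * ∑ t ∈ Finset.range T, err t := by
  refine regret_le_of_forall ⟨x₁, hx₁⟩ fun u hu => ?_
  set x := iterate K Lf L η δ T rec x₁ f ω with hx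
  set g := fun t =>
    gradEstimate rec δ (repetitions Lf L δ T (ω t).1) (f t ω) (ω t) (x t) with hgdef
  have hxK : ∀ t, x t ∈ K := iterate_mem hK hx₁ ω
  have hstep : ∀ t < T, f t ω (x t) - f t ω u
      ≤ (‖x t - u‖ ^ 2 - ‖x (t + 1) - u‖ ^ 2) / (2 * η) + η / 2 * ρ ^ 2 + 2 * R * err t := by
    intro t ht
    have h1 := (hf.admissible t ht ω).sub_le_inner (x t) u
    have h2 : inner ℝ (g t) (x t - u)
        ≤ (‖x t - u‖ ^ 2 - ‖x (t + 1) - u‖ ^ 2) / (2 * η) + η / 2 * ‖g t‖ ^ 2 :=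
      inner_le_of_step hK hc ⟨x₁, hx₁⟩ hη (x t) (g t) hu
    have h3 : ‖g t‖ ^ 2 ≤ ρ ^ 2 := pow_le_pow_left₀ (norm_nonneg _) (hg t ht) 2
    have h4 : inner ℝ (gradient (f t ω) (x t)) (x t - u)
        ≤ inner ℝ (g t) (x t - u) + 2 * R * err t := by
      have e : inner ℝ (gradient (f t ω) (x t)) (x t - u)
          = inner ℝ (g t) (x t - u) - inner ℝ (g t - gradient (f t ω) (x t)) (x t - u) := by
        rw [inner_sub_left]; ring
      have h5 := (abs_le.1 (abs_real_inner_le_norm (g t - gradient (f t ω) (x t)) (x t - u))).1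
      have h6 : ‖g t - gradient (f t ω) (x t)‖ * ‖x t - u‖ ≤ err t * (2 * R) :=
        mul_le_mul (herr t ht) (norm_sub_le_of_bounded hR (hxK t) hu) (norm_nonneg _)
          ((norm_nonneg _).trans (herr t ht))
      linarith
    have h7 : η / 2 * ‖g t‖ ^ 2 ≤ η / 2 * ρ ^ 2 := by gcongr
    linarith
  refine (Finset.sum_le_sum fun t ht => hstep t (Finset.mem_range.1 ht)).trans ?_
  rw [Finset.sum_add_distrib, Finset.sum_add_distrib, ← Finset.sum_div,
    Finset.sum_range_sub' (fun t => ‖x t - u‖ ^ 2), Finset.sum_const, Finset.card_range,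
    nsmul_eq_mul, ← Finset.mul_sum]
  -- After telescoping only the initial distance remains; the factor `1/2` in the definition of `D`
  -- matches `1/(2η)`.
  have h8 : (‖x 0 - u‖ ^ 2 - ‖x T - u‖ ^ 2) / (2 * η) ≤ halfSqDiam K / η := by
    rw [div_le_div_iff₀ (by positivity) hη]
    have := half_sq_le_halfSqDiam hR (hxK 0) hu
    nlinarith [sq_nonneg ‖x T - u‖]
  linarith

/-- The failure probability of a round. -/
lemma outcomeLaw_not_good_le (hs : 1 ≤ s) (hsd : s ≤ d) (hT : 1 ≤ T) (hLf : 0 ≤ Lf)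
    (hLδ : 0 < L * δ)
    (hm : 800 * (2 * s * Real.log (Real.exp 1 * d / (2 * s)) + Real.log (4 * T)) ≤ m)
    (hK : IsCompact K) (hc : Convex ℝ K) (hx₁ : x₁ ∈ K) (hf : IsAdversary K Lf L s T f)
    {τ ρ : ℝ} (hrec : IsBasisPursuit τ ρ rec) {t : ℕ} (ht : t < T) :
    MeasurableSet {ω | ¬ IsGoodSeed s Lf L δ T
      (gradient (f t ω) (iterate K Lf L η δ T rec x₁ f ω t)) (ω t)} ∧
    (outcomeLaw m d).real {ω | ¬ IsGoodSeed s Lf L δ T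
      (gradient (f t ω) (iterate K Lf L η δ T rec x₁ f ω t)) (ω t)} ≤ 2 / T := by
  have hY := hf.measurable_gradient ht
    (measurable_iterate (η := η) (δ := δ) hK hc ⟨x₁, hx₁⟩ hf hrec ht.le (x₁ := x₁))
  have hS : MeasurableSet {p : Vec d × Seed m d | ¬ IsGoodSeed s Lf L δ T p.1 p.2} :=
    (measurableSet_isGoodSeed m d s Lf L δ T).compl
  refine ⟨(hY.prodMk (measurable_pi_apply t)) hS,
    outcomeLaw_real_le hY (fun ω ω' h => ?_) hS (by positivity) fun ω => ?_⟩
  · simp only [iterate_congr hf ht.le h, hf.nonanticipating t ht ω ω' h]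
  · exact seedLaw_not_good_le hs hsd hT hLδ hm ((hf.admissible t ht ω).norm_gradient_le hLf _)

/-- A failed round has error at most `ρ + Lf = 2Lf + 3Lδ`. Its probability `2/T`, summed over `T`
rounds, leaves the factor `2` with no growth in `T`. -/
lemma integral_regret_le (hs : 1 ≤ s) (hsd : s ≤ d) (hT : 1 ≤ T) (hLf : 0 ≤ Lf) (hL : 0 < L)
    (hη : 0 < η) (hδ : 0 < δ) (hm0 : 0 < m)
    (hm : 800 * (2 * s * Real.log (Real.exp 1 * d / (2 * s)) + Real.log (4 * T)) ≤ m)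
    (hK : IsCompact K) (hc : Convex ℝ K) (hR : ∀ x ∈ K, ‖x‖ ≤ R) (hx₁ : x₁ ∈ K)
    (hf : IsAdversary K Lf L s T f)
    (hrec : IsBasisPursuit (3 * L * δ) (Lf + 3 * L * δ) rec) :
    ∫ ω, regret K Lf L η δ T rec x₁ f ω ∂(outcomeLaw m d)
      ≤ halfSqDiam K / η + T * (η / 2 * (Lf + 3 * L * δ) ^ 2)
        + 2 * R * (T * (6 * (3 * L * δ)) + 2 * (2 * Lf + 3 * L * δ)) := by
  have hT' : (0 : ℝ) < T := by exact_mod_cast hT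
  have hR0 : 0 ≤ R := (norm_nonneg _).trans (hR x₁ hx₁)
  set ρ := Lf + 3 * L * δ with hρ
  have hρ0 : 0 ≤ ρ := by positivity
  set bad : ℕ → Set (Outcome m d) := fun t => {ω | ¬ IsGoodSeed s Lf L δ T
      (gradient (f t ω) (iterate K Lf L η δ T rec x₁ f ω t)) (ω t)} with hbad
  have hprob := fun t (ht : t < T) => outcomeLaw_not_good_le (η := η) hs hsd hT hLf
    (mul_pos hL hδ) hm hK hc hx₁ hf hrec ht
  set err : ℕ → Outcome m d → ℝ := fun t ω =>
    6 * (3 * L * δ) + (bad t).indicator (fun _ => 2 * Lf + 3 * L * δ) ω with herr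
  have hpt : ∀ ω, regret K Lf L η δ T rec x₁ f ω
      ≤ halfSqDiam K / η + T * (η / 2 * ρ ^ 2)
        + 2 * R * ∑ t ∈ Finset.range T, err t ω := by
    intro ω
    refine regret_le_sum_error hK hc hf hη hR hx₁ ω (err := fun t => err t ω)
      (fun t _ => norm_gradEstimate_le hρ0 hrec _ _ _ _) fun t ht => ?_
    have had := hf.admissible t ht ω
    by_cases h : ω ∈ bad t
    · simp only [herr, Set.indicator_of_mem h]
      have h1 := norm_gradEstimate_le hρ0 hrec (δ := δ) (repetitions Lf L δ T (ω t).1) (f t ω) (ω t)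
        (iterate K Lf L η δ T rec x₁ f ω t)
      have h2 := had.norm_gradient_le hLf (iterate K Lf L η δ T rec x₁ f ω t)
      have h3 : 0 ≤ 6 * (3 * L * δ) := by positivity
      refine (norm_sub_le _ _).trans ?_
      linarith
    · simp only [herr, Set.indicator_of_notMem h, add_zero]
      exact (not_not.1 h).norm_gradEstimate_sub_le hs hm0 hLf hL.le hδ hrec had
        (iterate_mem hK hx₁ ω t)
  have hierr : ∀ t ∈ Finset.range T, Integrable (err t) (outcomeLaw m d) := fun t ht =>
    (integrable_const _).add ((integrable_const _).indicator (hprob t (Finset.mem_range.1 ht)).1)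
  have hIsum : Integrable (fun ω => ∑ t ∈ Finset.range T, err t ω) (outcomeLaw m d) :=
    integrable_finsetSum _ hierr
  have hE : ∀ t ∈ Finset.range T, ∫ ω, err t ω ∂(outcomeLaw m d)
      ≤ 6 * (3 * L * δ) + 2 / T * (2 * Lf + 3 * L * δ) := by
    intro t ht
    obtain ⟨h1, h2⟩ := hprob t (Finset.mem_range.1 ht)
    rw [herr]
    dsimp only
    rw [integral_add (integrable_const _) ((integrable_const _).indicator h1),
      integral_indicator_const _ h1]
    simp only [integral_const, probReal_univ, smul_eq_mul, one_mul]
    gcongr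
  calc ∫ ω, regret K Lf L η δ T rec x₁ f ω ∂(outcomeLaw m d)
      ≤ ∫ ω, (halfSqDiam K / η + T * (η / 2 * ρ ^ 2)
        + 2 * R * ∑ t ∈ Finset.range T, err t ω) ∂(outcomeLaw m d) :=
        integral_mono (integrable_regret hK hc hf hLf hR hx₁ hrec)
          ((integrable_const _).add (hIsum.const_mul _)) hpt
    _ = halfSqDiam K / η + T * (η / 2 * ρ ^ 2)
        + 2 * R * ∑ t ∈ Finset.range T, ∫ ω, err t ω ∂(outcomeLaw m d) := by
        rw [integral_add (integrable_const _) (hIsum.const_mul _), integral_const_mul,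
          integral_finsetSum _ hierr]
        simp
    _ ≤ halfSqDiam K / η + T * (η / 2 * ρ ^ 2)
        + 2 * R * ∑ _t ∈ Finset.range T, (6 * (3 * L * δ) + 2 / T * (2 * Lf + 3 * L * δ)) := by
        gcongr with t ht
        exact hE t ht
    _ = _ := by
        rw [Finset.sum_const, Finset.card_range, nsmul_eq_mul]
        field_simp

end Regret

end Congo

theorem mainTheorem3 :
    ∃ C : ℝ, 0 < C ∧ ∀ r : ℝ, 0 < r → ∃ c : ℝ, 0 < c ∧
      ∀ (d s T m : ℕ) (Lf L R η δ : ℝ) (K : Set (Congo.Vec d)) (x₁ : Congo.Vec d)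
        (rec : Congo.Mat m d → Congo.Vec m → Congo.Vec d)
        (f : ℕ → Congo.Outcome m d → Congo.Vec d → ℝ),
        1 ≤ s → s ≤ d → 1 ≤ T → 0 < Lf → 0 < L → r ≤ R →
        IsCompact K → Convex ℝ K → (∀ x ∈ K, ‖x‖ ≤ R) → x₁ ∈ K →
        η = 1 / (Lf * √(T : ℝ)) →
        δ = 1 / (3 * L * T) →
        m = ⌈C * (2 * s * Real.log (Real.exp 1 * d / (2 * s)) + Real.log (4 * T))⌉₊ →
        Congo.IsBasisPursuit (3 * L * δ) (Lf + 3 * L * δ) rec →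
        Congo.IsAdversary K Lf L s T f →
        (MeasureTheory.Integrable (Congo.regret K Lf L η δ T rec x₁ f) (Congo.outcomeLaw m d) ∧
          ∫ ω, Congo.regret K Lf L η δ T rec x₁ f ω ∂(Congo.outcomeLaw m d)
            ≤ c * ((Congo.halfSqDiam K + R / 2 + 4 * R / Lf) * Lf * √(T : ℝ))) ∧
        ∀ t < T,
          MeasureTheory.Integrable
            (fun ω => (Congo.numSamples K Lf L η δ T rec x₁ f t ω : ℝ)) (Congo.outcomeLaw m d) ∧
          ∫ ω, (Congo.numSamples K Lf L η δ T rec x₁ f t ω : ℝ) ∂(Congo.outcomeLaw m d)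
            ≤ 36 * d * ((m : ℝ) - 1) ^ 2 * Lf ^ 2 * Real.log (2 * m) * (T : ℝ) ^ 2
                * Real.log (2 * m * T) + 2 := by
  -- The part `4/r` times `R/2` supplies the `2 Lf √T` coming from the step-size term, which has no
  -- factor `R`; this is where a lower bound on `R` enters. The part `20` covers the remaining
  -- terms.
  refine ⟨800, by norm_num, fun r hr => ⟨20 + 4 / r, by positivity, ?_⟩⟩
  intro d s T m Lf L R η δ K x₁ rec f hs hsd hT hLf hL hrR hK hc hKR hx₁ hη hδ hm hrec hf
  have hT' : (1 : ℝ) ≤ T := by exact_mod_cast hT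
  have hs' : (1 : ℝ) ≤ s := by exact_mod_cast hs
  have hmC : 800 * (2 * s * Real.log (Real.exp 1 * d / (2 * s)) + Real.log (4 * T)) ≤ m := by
    rw [hm]; exact Nat.le_ceil _
  have hm8 : 8 ≤ m := by
    have h1 := Congo.log_sparsity_ge hs hsd
    have h2 : 0 ≤ Real.log (4 * T) := Real.log_nonneg (by linarith)
    have : (8 : ℝ) ≤ m := by nlinarith
    exact_mod_cast this
  have hLδ : L * δ = 1 / (3 * T) := by rw [hδ]; field_simp
  have hLδ3 : 3 * L * δ = 1 / T := by rw [mul_assoc, hLδ]; field_simp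
  have hδ0 : 0 < δ := by rw [hδ]; positivity
  have hη0 : 0 < η := by rw [hη]; positivity
  refine ⟨⟨Congo.integrable_regret hK hc hf hLf.le hKR hx₁ hrec, ?_⟩,
    fun t _ => Congo.integral_numSamples_le hm8 hT hLδ⟩
  have hD : 0 ≤ Congo.halfSqDiam K := by
    simpa using Congo.half_sq_le_halfSqDiam hKR hx₁ hx₁
  have hR : 0 < R := hr.trans_le hrR
  set S := √(T : ℝ) with hS
  have hSS : S * S = T := Real.mul_self_sqrt (by linarith)
  have hS1 : 1 ≤ S := Real.one_le_sqrt.2 hT'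
  set D := Congo.halfSqDiam K
  have hform : (20 + 4 / r) * ((D + R / 2 + 4 * R / Lf) * Lf * S)
      = (20 + 4 / r) * (D * Lf * S) + 10 * (R * Lf * S) + 2 * (R / r) * (Lf * S)
        + (80 + 16 / r) * (R * S) := by
    field_simp
    ring
  rw [hform]
  have hRr : 1 ≤ R / r := (one_le_div hr).2 hrR
  have hr4 : 0 < 4 / r := by positivity
  have hr16 : 0 < 16 / r := by positivity
  have p1 : 0 ≤ D * Lf * S := by positivity
  have p2 : 0 ≤ R * Lf * S := by positivity
  have p3 : 0 ≤ Lf * S := by positivity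
  have p4 : R ≤ R * S := le_mul_of_one_le_right hR.le hS1
  have q1 : 0 ≤ 4 / r * (D * Lf * S) := by positivity
  have q2 : Lf * S ≤ R / r * (Lf * S) := le_mul_of_one_le_left p3 hRr
  have q3 : 0 ≤ 16 / r * (R * S) := by positivity
  -- If `Lf T ≤ 1`, the deterministic bound `2R Lf T ≤ 2R` suffices. Otherwise `1/T ≤ Lf`, so the
  -- estimates have norm at most `2Lf`.
  rcases le_total (Lf * T) 1 with hsmall | hlarge
  · have h1 : ∫ ω, Congo.regret K Lf L η δ T rec x₁ f ω ∂(Congo.outcomeLaw m d)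
        ≤ T * (Lf * (2 * R)) := by
      refine (MeasureTheory.integral_mono (Congo.integrable_regret hK hc hf hLf.le hKR hx₁ hrec)
        (MeasureTheory.integrable_const _)
        fun ω => Congo.regret_le_trivial hK hf hLf.le hKR hx₁ ω).trans_eq (by simp)
    have h2 : T * (Lf * (2 * R)) ≤ 2 * R := by nlinarith
    linarith
  · have h1 := Congo.integral_regret_le hs hsd hT hLf.le hL hη0 hδ0 (by omega) hmC hK hc hKR hx₁
      hf hrec
    rw [hLδ3] at h1
    have h2 : D / η = D * Lf * S := by rw [hη]; field_simp
    have h3 : 1 / (T : ℝ) ≤ Lf := by rw [div_le_iff₀ (by linarith)]; exact hlarge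
    have h4 : T * (η / 2 * (Lf + 1 / T) ^ 2) ≤ 2 * (Lf * S) := by
      calc T * (η / 2 * (Lf + 1 / T) ^ 2) ≤ T * (η / 2 * (Lf + Lf) ^ 2) := by gcongr
        _ = 2 * (Lf * S) := by
            rw [hη, ← hSS]; field_simp; ring
    have h5 : 2 * R * (T * (6 * (1 / T)) + 2 * (2 * Lf + 1 / T)) ≤ 16 * R + 8 * (R * Lf) := by
      have e : (T : ℝ) * (6 * (1 / T)) = 6 := by field_simp
      have e2 : 1 / (T : ℝ) ≤ 1 := (div_le_one (by linarith)).2 hT'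
      rw [e]
      nlinarith
    have h6 : R * Lf ≤ R * Lf * S := le_mul_of_one_le_right (by positivity) hS1
    linarith
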